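/- Let $0<q<1$ and let $c,d>0$ with $qc<d$. Write $(a;q)_n=\prod_{i=0}^{n-1}(1-aq^i)$, $(a;q)_\infty=\prod_{i\ge0}(1-aq^i)$, $(a,b;q)_\infty=(a;q)_\infty(b;q)_\infty$, $\theta(x;q)=(x,q/x;q)_\infty$, $\mathbb N=\{0,1,2,\dots\}$, $${}_1\varphi_1(a;b;q,z)=\sum_{n\ge0}\frac{(a;q)_n}{(q;q)_n(b;q)_n}(-1)^nq^{n(n-1)/2}z^n .$$ Let $I_q=\{q^{-k}/c:k\in\mathbb N\}$, let $W(q^{-k}/c)=(c/d)^kq^{k(k+1)}(cq^{k+1}/d,q^{k+1};q)_\infty$ (which is positive), and let $H$ be the Hilbert space of functions $f:I_q\to\mathbb C$ of finite norm for $$\langle f,g\rangle_H=(1-q)\sum_{k\ge0}f(q^{-k}/c)\,\overline{g(q^{-k}/c)}\,W(q^{-k}/c)\,\frac{q^{-k}}{c}.$$ With $A(x)=(1-\frac1{cx})(1-\frac1{dx})$ and $B(x)=\frac q{cdx^2}$ let $$(Lf)(x)=A(x)\big(f(qx)-f(x)\big)+B(x)\big(f(x/q)-f(x)\big)\quad(x\in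 I_q,\ x\ne1/c),\qquad (Lf)(1/c)=B(1/c)\big(f(1/(cq))-f(1/c)\big).$$ For $\gamma\in\mathbb C\setminus\{0\}$ and $k\in\mathbb N$ put $$\Psi_\gamma(q^{-k}/c)=q^{-k(k+1)/2}\Big(-\frac dc\Big)^k\frac{(\gamma q^{1-k};q)_\infty}{(cq^{k+1}/d;q)_\infty}\,{}_1\varphi_1\Big(q\gamma;\gamma q^{1-k};q,\frac{cq}d\Big),$$ $$\phi_\gamma(q^{-k}/c)=\frac{(q\gamma;q)_\infty\,\gamma^{-k}\,(q^{k+1}/\gamma;q)_\infty}{(q^{k+1},cq^{k+1}/d;q)_\infty}\,{}_1\varphi_1\Big(q^{k+1};\frac{q^{k+1}}\gamma;q,\frac{cq^{k+1}}{d\gamma}\Big),$$ where $(b;q)_\infty\,{}_1\varphi_1(a;b;q,z)$ is understood as an entire function of $b$, and put $C(\gamma)=\theta(d\gamma/c;q)/\theta(d/c;q)$, extended by continuity in $d/c$ when $\theta(d/c;q)=0$. For all $\gamma\neq0$ the Casorati determinant $$\widetilde D(\gamma)=\big(\phi_\gamma(x)\Psi_\gamma(qx)-\phi_\gamma(qx)\Psi_\gamma(x)\big)(1-q)\,x\,A(x)W(x),\qquad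 x\in I_q\setminus\{1/c\},$$ does not depend on $x$. Let $$V_n^{(a)}(z;q)=(-a)^nq^{-n(n-1)/2}\sum_{k=0}^n\frac{(q^{-n};q)_k(z;q)_k}{(q;q)_k}(-1)^kq^{-k(k-1)/2}\Big(\frac{q^n}a\Big)^k$$ be the Al-Salam–Carlitz II polynomials. (i) $L$ is a bounded self-adjoint operator on $H$. Its discrete spectrum (isolated points of the spectrum that are eigenvalues of finite multiplicity) is $q^{\mathbb N}-1=\{q^n-1:n\in\mathbb N\}$, its continuous spectrum is $\{-1\}$, and its spectrum is the union of these two sets. For $\gamma\in q^{\mathbb N}$ one has $\phi_\gamma\in H$, and if $(a,b)$ is an open interval with $(a,b)\cap(q^{\mathbb N}-1)=\{\gamma-1\}$, then the spectral measure $E$ of $L$ satisfies $$\langle E(a,b)f,g\rangle_H=-\frac1{C(\gamma)}\operatorname*{Res}_{\gamma'=\gamma}\frac1{\widetilde D(\gamma')}\,\langle f,\phi_\gamma\rangle_H\,\langle\phi_\gamma,g\rangle_H,\qquad f,g\in H.$$ (ii) The functions $x\mapsto V_n^{(c/d)}(cx;q)$, $n\in\mathbb N$, form an orthogonal basis of $H$,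 with squared norm $$\big\|V_n^{(c/d)}(c\,\cdot\,;q)\big\|_H^2=\frac{1-q}c\,(q;q)_\infty\Big(\frac cd\Big)^nq^{-n^2}(q;q)_n .$$ -/

import Mathlib

open Filter Topology MeasureTheory
open scoped Real

noncomputable section

namespace AlSalamCarlitz

/-! ### q-shifted factorials, theta function, basic hypergeometric series -/

/-- The finite `q`-shifted factorial `(a;q)_n = ∏_{i<n} (1 - a q^i)`. -/
def qPoch {K : Type*} [CommRing K] (a q : K) (n : ℕ) : K :=
  ∏ i ∈ Finset.range n, (1 - a * q ^ i)

/-- The infinite `q`-shifted factorial `(a;q)_∞ = ∏_{i≥0} (1 - a q^i)` (convergent for `|q| < 1`). -/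
def qPochInf {K : Type*} [CommRing K] [TopologicalSpace K] (a q : K) : K :=
  ∏' i : ℕ, (1 - a * q ^ i)

/-- The theta function `θ(x;q) = (x;q)_∞ (q/x;q)_∞`. -/
def qTheta (q x : ℂ) : ℂ := qPochInf x q * qPochInf (q / x) q

/-- The function `(b;q)_∞ · ₁φ₁(a;b;q,z)`, entire in `a`, `b`, `z`, that is
`∑_n (a;q)_n (b q^n;q)_∞ / (q;q)_n · (-1)^n q^{n(n-1)/2} z^n`. -/
def regPhi11 (q a b z : ℂ) : ℂ :=
  ∑' n : ℕ, qPoch a q n * qPochInf (b * q ^ n) q / qPoch q q n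
    * ((-1) ^ n * q ^ (n.choose 2)) * z ^ n

/-- The terminating series
`₂φ₀(q^{-n}, z; -; q, w) = ∑_{k≤n} (q^{-n};q)_k (z;q)_k / (q;q)_k · [(-1)^k q^{k(k-1)/2}]⁻¹ w^k`. -/
def phi20 (q : ℝ) (n : ℕ) (z w : ℝ) : ℝ :=
  ∑ k ∈ Finset.range (n + 1), qPoch ((q ^ n)⁻¹) q k * qPoch z q k / qPoch q q k
    * ((-1) ^ k * q ^ (k.choose 2))⁻¹ * w ^ k

/-- The Al-Salam--Carlitz polynomials of type II,
`V_n^{(a)}(z;q) = (-a)^n q^{-n(n-1)/2} ₂φ₀(q^{-n}, z; -; q, q^n/a)`. -/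
def polyV (a q : ℝ) (n : ℕ) (z : ℝ) : ℝ :=
  (-a) ^ n * (q ^ (n.choose 2))⁻¹ * phi20 q n z (q ^ n / a)

/-! ### The Hilbert space `H`

Functions on `I_q = {q^{-k}/c : k ∈ ℕ}` are identified with functions on `ℕ` through
`k ↦ q^{-k}/c`. -/

/-- The points `q^{-k}/c` of `I_q`. -/
def pt (q c : ℝ) (k : ℕ) : ℝ := (q ^ k)⁻¹ / c

/-- The weight `W(q^{-k}/c) = (c/d)^k q^{k(k+1)} (c q^{k+1}/d;q)_∞ (q^{k+1};q)_∞`. -/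
def weightW (q c d : ℝ) (k : ℕ) : ℝ :=
  (c / d) ^ k * q ^ (k * (k + 1)) * qPochInf (c * q ^ (k + 1) / d) q * qPochInf (q ^ (k + 1)) q

/-- The measure `W(x) d_q x` on `I_q`; its mass at the point `q^{-k}/c` is
`(1-q) W(q^{-k}/c) q^{-k}/c`. -/
def jacksonMeasure (q c d : ℝ) : Measure ℕ :=
  Measure.sum fun k : ℕ =>
    ENNReal.ofReal ((1 - q) * weightW q c d k * pt q c k) • Measure.dirac k

/-- The Hilbert space `H = L²(I_q, W d_q x)`. Mathlib's inner product is linear in its second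
argument, so `⟨f, g⟩_H = ∫ f ḡ W d_q x` is `inner ℂ g f`. -/
abbrev HilbertH (q c d : ℝ) : Type := Lp ℂ 2 (jacksonMeasure q c d)

/-! ### The operator `L` -/

/-- `A(x) = (1 - 1/(cx)) (1 - 1/(dx))`. -/
def coeffA (c d x : ℝ) : ℝ := (1 - 1 / (c * x)) * (1 - 1 / (d * x))

/-- `B(x) = q/(cd x²)`. -/
def coeffB (q c d x : ℝ) : ℝ := q / (c * d * x ^ 2)

/-- `(Lf)(x) = A(x) (f(qx) - f(x)) + B(x) (f(x/q) - f(x))` for `x ∈ I_q`, `x ≠ 1/c`, with the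
boundary condition `(Lf)(1/c) = B(1/c) (f(1/(cq)) - f(1/c))`. -/
def opL (q c d : ℝ) (f : ℕ → ℂ) : ℕ → ℂ
  | 0 => (coeffB q c d (pt q c 0) : ℂ) * (f 1 - f 0)
  | k + 1 => (coeffA c d (pt q c (k + 1)) : ℂ) * (f k - f (k + 1))
      + (coeffB q c d (pt q c (k + 1)) : ℂ) * (f (k + 2) - f (k + 1))

/-! ### Eigenfunctions, Casorati determinant, connection coefficient -/

/-- `Ψ_γ(q^{-k}/c) = q^{-k(k+1)/2} (-d/c)^k (γ q^{1-k};q)_∞ / (c q^{k+1}/d;q)_∞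
  · ₁φ₁(qγ; γ q^{1-k}; q, cq/d)`. -/
def eigPsi (q c d : ℝ) (γ : ℂ) (k : ℕ) : ℂ :=
  ((q : ℂ) ^ ((k + 1).choose 2))⁻¹ * (-(d : ℂ) / c) ^ k
    / qPochInf ((c : ℂ) * q ^ (k + 1) / d) (q : ℂ)
    * regPhi11 q (q * γ) (γ * q / q ^ k) (c * q / d)

/-- `φ_γ(q^{-k}/c) = (qγ;q)_∞ γ^{-k} (q^{k+1}/γ;q)_∞ / ((q^{k+1};q)_∞ (c q^{k+1}/d;q)_∞)
  · ₁φ₁(q^{k+1}; q^{k+1}/γ; q, c q^{k+1}/(dγ))` for `γ ≠ 0`. This is the value at `z = 1/c`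
(by continuity) of
`(qγ;q)_∞ θ(cγz;q) / θ(cz;q) · (cx;q)_∞ / ((q/(dx);q)_∞ (cγx;q)_∞)
  · ₁φ₁(q/(cx); q/(cγx); q, q/(dγx))`, where `x = z q^{-k}`. -/
def eigPhi (q c d : ℝ) (γ : ℂ) (k : ℕ) : ℂ :=
  qPochInf (q * γ) (q : ℂ) * (γ ^ k)⁻¹
    / (qPochInf ((q : ℂ) ^ (k + 1)) (q : ℂ) * qPochInf ((c : ℂ) * q ^ (k + 1) / d) (q : ℂ))
    * regPhi11 q ((q : ℂ) ^ (k + 1)) ((q : ℂ) ^ (k + 1) / γ) (c * q ^ (k + 1) / (d * γ))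

/-- The Casorati determinant
`D(f,g)(x) = (f(x) g(qx) - f(qx) g(x)) · (1-q) x A(x) W(x)` at the point `x = q^{-(j+1)}/c`. -/
def casorati (q c d : ℝ) (f g : ℕ → ℂ) (j : ℕ) : ℂ :=
  (f (j + 1) * g j - f j * g (j + 1)) *
    (((1 - q) * pt q c (j + 1) * coeffA c d (pt q c (j + 1)) * weightW q c d (j + 1) : ℝ) : ℂ)

/-- `D(γ) = D(φ_γ, Ψ_γ)`, evaluated at the point `q^{-1}/c`. -/
def detD (q c d : ℝ) (γ : ℂ) : ℂ := casorati q c d (eigPhi q c d γ) (eigPsi q c d γ) 0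

open Classical in
/-- `C(γ) = θ(dγ/c;q) / θ(d/c;q)`, which is extended by continuity in `d/c` when `d/c` is a zero of
`θ(·;q)`. -/
def connC (q c d : ℝ) (γ : ℂ) : ℂ :=
  if qTheta q ((d : ℂ) / c) ≠ 0 then qTheta q ((d : ℂ) / c * γ) / qTheta q ((d : ℂ) / c)
  else limUnder (𝓝[≠] ((d : ℂ) / c)) fun t : ℂ => qTheta q (t * γ) / qTheta q t

/-- The residue of `f` at an isolated singularity `z₀`: the value of
`(2πi)⁻¹ ∮_{|z - z₀| = r} f(z) dz` for all small `r > 0`. -/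
def residueAt (f : ℂ → ℂ) (z₀ : ℂ) : ℂ :=
  limUnder (𝓝[>] (0 : ℝ)) fun r : ℝ => (2 * π * Complex.I)⁻¹ * ∮ z in C(z₀, r), f z

/-! ### Spectral notions for bounded operators -/

section Spectral

variable {H : Type*} [NormedAddCommGroup H] [InnerProductSpace ℂ H] [CompleteSpace H]

/-- The discrete spectrum: isolated points of the spectrum which are eigenvalues of finite
multiplicity. -/
def discreteSpec (T : H →L[ℂ] H) : Set ℂ :=
  {z | (∃ U ∈ 𝓝 z, U ∩ spectrum ℂ T = {z}) ∧
    Module.End.HasEigenvalue (T : H →ₗ[ℂ] H) z ∧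
    FiniteDimensional ℂ (Module.End.eigenspace (T : H →ₗ[ℂ] H) z)}

/-- The continuous spectrum: `T - z` is injective with dense range, but not surjective. -/
def continuousSpec (T : H →L[ℂ] H) : Set ℂ :=
  {z | Function.Injective (T - z • (1 : H →L[ℂ] H)) ∧
    DenseRange (T - z • (1 : H →L[ℂ] H)) ∧
    ¬ Function.Surjective (T - z • (1 : H →L[ℂ] H))}

/-- `E` is the spectral measure of the bounded self-adjoint operator `T`: on Borel subsets of `ℝ`
it is a projection-valued measure, and `T = ∫ x dE(x)` in the weak sense. -/
structure IsSpectralMeasure (T : H →L[ℂ] H) (E : Set ℝ → H →L[ℂ] H) : Prop where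
  proj : ∀ s, MeasurableSet s → IsStarProjection (E s)
  univ : E Set.univ = 1
  inter : ∀ s t, MeasurableSet s → MeasurableSet t → E (s ∩ t) = E s * E t
  iUnion : ∀ s : ℕ → Set ℝ, (∀ i, MeasurableSet (s i)) →
    Pairwise (Function.onFun Disjoint s) → ∀ f : H, HasSum (fun i => E (s i) f) (E (⋃ i, s i) f)
  integral : ∀ f : H, ∃ μ : Measure ℝ,
    (∀ s, MeasurableSet s → μ s = ENNReal.ofReal (inner ℂ f (E s f)).re) ∧
    Integrable (fun x : ℝ => x) μ ∧
    inner ℂ f (T f) = ((∫ x : ℝ, x ∂μ : ℝ) : ℂ)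

end Spectral

end AlSalamCarlitz

end

noncomputable section

namespace AlSalamCarlitz

/-! ### Basic facts on `q`-shifted factorials -/

section QSeries

/-! The points of `I_q` are indexed by `k : ℕ`, so that `L` is a Jacobi (three-term) operator, and
the theorem follows by diagonalising it explicitly.

Algebra. Both families `φ_γ` and `Ψ_γ` satisfy a lowering relation (a first difference in `k` sends
`γ` to `γ/q`) and a raising relation (sending `γ` to `qγ`). These come from contiguous relations for
`(b;q)_∞ ₁φ₁`, and composing them gives `Lf = (γ-1)f` away from `1/c`. At `1/c` the function `Ψ_γ`
satisfies the boundary equation for every `γ`, while `φ_γ` misses it by a multiple of `θ(γ;q)`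
(`eigPhi_opL_zero`). This defect yields the product formula for the Casorati determinant
(`detD_eq`). It vanishes at `γ = q^n`, where `φ_γ` is a multiple of the polynomial `V_n`
(`eigPhi_pow`).

Orthogonality. Raising and lowering are adjoint up to a factor (`seqV_summation_by_parts`), so
`⟨V_{m+1}, V_{n+1}⟩` is a multiple of `⟨V_m, V_n⟩`. This gives orthogonality and all norms relative
to that of `V_0`.

Completeness. The Hilbert–Schmidt norm of `L + 1`, computed row by row, has square `1/(1-q²) = ∑
q^{2n}` (`hasSum_rowWeight`). The eigenvalues `q^n` of the `V_n` already exhaust it, so by Bessel's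
inequality `L + 1` vanishes on the orthogonal complement of the `V_n` (`rowVec_orthogonal`). Since
`qc < d`, the equation `Lf = -f` has no nonzero solution in `H` (`eq_zero_of_opL_eq_neg`), so the
complement is zero. Parseval's identity for evaluation at `1/c` then gives the norm of `V_0`
(`innerV_zero_zero`).

Spectrum. `L` is thus diagonal in a Hilbert basis with simple eigenvalues `q^n - 1 → -1`, which
determines its spectrum and forces every spectral measure to act by indicator functions of the
eigenvalues (`IsSpectralMeasure.inner_basis`). The stated constant is the one that normalises the
projection onto `φ_γ`, because `D` has a simple zero at `q^n` with explicit derivative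
(`residue_mul_norm_sq`). -/

@[simp] lemma qPoch_zero {K : Type*} [CommRing K] (a q : K) : qPoch a q 0 = 1 := by
  simp [qPoch]

lemma qPoch_succ {K : Type*} [CommRing K] (a q : K) (n : ℕ) :
    qPoch a q (n + 1) = qPoch a q n * (1 - a * q ^ n) := by
  simp [qPoch, Finset.prod_range_succ]

lemma qPoch_succ' {K : Type*} [CommRing K] (a q : K) (n : ℕ) :
    qPoch a q (n + 1) = (1 - a) * qPoch (q * a) q n := by
  rw [qPoch, Finset.prod_range_succ', qPoch, mul_comm]
  congr 1
  · simp
  · exact Finset.prod_congr rfl fun i _ => by ring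

variable {q : ℂ}

lemma summable_mul_pow (hq : ‖q‖ < 1) (a : ℂ) : Summable fun i : ℕ => ‖-(a * q ^ i)‖ := by
  simp only [norm_neg, norm_mul, norm_pow]
  exact (summable_geometric_of_lt_one (norm_nonneg q) hq).mul_left _

lemma multipliable_one_sub (hq : ‖q‖ < 1) (a : ℂ) :
    Multipliable fun i : ℕ => 1 - a * q ^ i := by
  simpa [sub_eq_add_neg] using multipliable_one_add_of_summable (summable_mul_pow hq a)

lemma tendsto_qPoch (hq : ‖q‖ < 1) (a : ℂ) :
    Tendsto (qPoch a q) atTop (𝓝 (qPochInf a q)) :=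
  (multipliable_one_sub hq a).hasProd.tendsto_prod_nat

lemma qPochInf_eq_mul (hq : ‖q‖ < 1) (a : ℂ) :
    qPochInf a q = (1 - a) * qPochInf (q * a) q := by
  refine tendsto_nhds_unique ((tendsto_add_atTop_iff_nat 1).2 (tendsto_qPoch hq a)) ?_
  simp only [qPoch_succ']
  exact (tendsto_qPoch hq _).const_mul _

lemma qPochInf_eq_qPoch_mul (hq : ‖q‖ < 1) (a : ℂ) (n : ℕ) :
    qPochInf a q = qPoch a q n * qPochInf (a * q ^ n) q := by
  induction n with
  | zero => simp
  | succ n ih =>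
    rw [ih, qPoch_succ, qPochInf_eq_mul hq (a * q ^ n)]
    ring_nf

lemma qPochInf_ne_zero (hq : ‖q‖ < 1) {a : ℂ} (ha : ‖a‖ < 1) : qPochInf a q ≠ 0 := by
  have := tprod_one_add_ne_zero_of_summable (f := fun i : ℕ => -(a * q ^ i)) (fun i => ?_)
    (summable_mul_pow hq a)
  · simpa [qPochInf, sub_eq_add_neg] using this
  · intro h
    have h1 : a * q ^ i = 1 := by linear_combination -h
    have h2 : ‖a * q ^ i‖ < 1 := by
      rw [norm_mul, norm_pow]
      exact (mul_le_of_le_one_right (norm_nonneg _)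
        (pow_le_one₀ (norm_nonneg _) hq.le)).trans_lt ha
    simp [h1] at h2

lemma qPoch_ne_zero_of_norm_lt (hq : ‖q‖ < 1) {a : ℂ} (ha : ‖a‖ < 1) (n : ℕ) :
    qPoch a q n ≠ 0 := by
  have := qPochInf_ne_zero hq ha
  rw [qPochInf_eq_qPoch_mul hq a n] at this
  exact left_ne_zero_of_mul this

lemma one_sub_pow_ne_zero (hq : ‖q‖ < 1) (n : ℕ) : 1 - q ^ (n + 1) ≠ 0 := by
  intro h
  have h1 : q ^ (n + 1) = 1 := by linear_combination -h
  have h2 : ‖q ^ (n + 1)‖ < 1 := by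
    rw [norm_pow]; exact pow_lt_one₀ (norm_nonneg _) hq (by simp)
  simp [h1] at h2

lemma summable_pow_choose (hq : ‖q‖ < 1) (z : ℂ) :
    Summable fun n : ℕ => ‖q ^ (n.choose 2) * z ^ n‖ := by
  -- The ratio test below needs nonzero terms, so `q = 0` and `z = 0`, where the series is finite,
  -- are treated apart.
  rcases eq_or_ne q 0 with rfl | hq0
  · refine summable_of_ne_finset_zero (s := Finset.range 2) fun n hn => ?_
    have : n.choose 2 ≠ 0 := (Nat.choose_pos (by simpa [Nat.succ_le_iff] using hn)).ne'
    simp [this]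
  rcases eq_or_ne z 0 with rfl | hz0
  · refine summable_of_ne_finset_zero (s := Finset.range 1) fun n hn => ?_
    have : n ≠ 0 := by simpa using hn
    simp [this]
  refine summable_of_ratio_test_tendsto_lt_one (l := 0) zero_lt_one
    (Eventually.of_forall fun n => by simp [hq0, hz0]) ?_
  have h : Tendsto (fun n : ℕ => ‖q‖ ^ n * ‖z‖) atTop (𝓝 0) := by
    simpa using (tendsto_pow_atTop_nhds_zero_of_lt_one (norm_nonneg q) hq).mul_const ‖z‖
  refine h.congr fun n => ?_
  have h1 : ‖q‖ ≠ 0 := by simpa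
  have h2 : ‖z‖ ≠ 0 := by simpa
  rw [Nat.choose_succ_succ' n 1]
  simp only [norm_mul, norm_pow, norm_norm, Nat.choose_one_right]
  field_simp
  ring

/-- Euler's series for `(z;q)_∞`. -/
def eulerTerm (q z : ℂ) (n : ℕ) : ℂ := (-1) ^ n * q ^ (n.choose 2) * z ^ n / qPoch q q n

lemma exists_norm_inv_qPoch_le (hq : ‖q‖ < 1) : ∃ C, ∀ n, ‖(qPoch q q n)⁻¹‖ ≤ C := by
  have h := ((tendsto_qPoch hq q).inv₀ (qPochInf_ne_zero hq hq)).norm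
  obtain ⟨C, hC⟩ := h.bddAbove_range
  exact ⟨C, fun n => hC ⟨n, rfl⟩⟩

lemma exists_norm_qPoch_le (hq : ‖q‖ < 1) (a : ℂ) : ∃ C, ∀ n, ‖qPoch a q n‖ ≤ C := by
  obtain ⟨C, hC⟩ := (tendsto_qPoch hq a).norm.bddAbove_range
  exact ⟨C, fun n => hC ⟨n, rfl⟩⟩

lemma exists_eulerTerm_bound (hq : ‖q‖ < 1) (r : ℝ) :
    ∃ u : ℕ → ℝ, Summable u ∧ ∀ n z, ‖z‖ ≤ r → ‖eulerTerm q z n‖ ≤ u n := by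
  obtain ⟨C, hC⟩ := exists_norm_inv_qPoch_le hq
  refine ⟨fun n => ‖q ^ (n.choose 2) * (r : ℂ) ^ n‖ * C, (summable_pow_choose hq r).mul_right _,
    fun n z hz => ?_⟩
  have h0 : 0 ≤ r := (norm_nonneg z).trans hz
  rw [eulerTerm, div_eq_mul_inv, norm_mul]
  refine mul_le_mul ?_ (hC n) (norm_nonneg _) (norm_nonneg _)
  simp only [norm_mul, norm_pow, norm_neg, norm_one, one_pow, one_mul, Complex.norm_real,
    Real.norm_eq_abs, abs_of_nonneg h0]
  gcongr

lemma summable_eulerTerm (hq : ‖q‖ < 1) (z : ℂ) : Summable (eulerTerm q z) := by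
  obtain ⟨u, hu, h⟩ := exists_eulerTerm_bound hq ‖z‖
  exact hu.of_norm_bounded fun n => h n z le_rfl

lemma differentiable_tsum_eulerTerm (hq : ‖q‖ < 1) :
    Differentiable ℂ fun z => ∑' n, eulerTerm q z n := by
  intro z
  obtain ⟨u, hu, h⟩ := exists_eulerTerm_bound hq (‖z‖ + 1)
  have h1 : DifferentiableOn ℂ (fun z => ∑' n, eulerTerm q z n) (Metric.ball 0 (‖z‖ + 1)) := by
    refine Complex.differentiableOn_tsum_of_summable_norm hu (fun n => ?_) Metric.isOpen_ball
      fun n w hw => h n w ?_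
    · unfold eulerTerm
      fun_prop
    · simpa using (mem_ball_zero_iff.1 hw).le
  exact h1.differentiableAt (Metric.isOpen_ball.mem_nhds (by simp))

/-- The difference of the series at `z` and at `qz` cancels the factor `1 - q^{n+1}` of
`(q;q)_{n+1}`, which leaves `-z` times the series at `qz`. This is the functional equation of the
infinite product. -/
lemma tsum_eulerTerm_eq_mul (hq : ‖q‖ < 1) (z : ℂ) :
    ∑' n, eulerTerm q z n = (1 - z) * ∑' n, eulerTerm q (q * z) n := by
  have h1 := (summable_eulerTerm hq z)
  have h2 := (summable_eulerTerm hq (q * z))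
  have h3 : ∑' n, (eulerTerm q z n - eulerTerm q (q * z) n)
      = ∑' n, -z * eulerTerm q (q * z) n := by
    rw [(h1.sub h2).tsum_eq_zero_add]
    have : ∀ n, eulerTerm q z (n + 1) - eulerTerm q (q * z) (n + 1)
        = -z * eulerTerm q (q * z) n := fun n => by
      have e1 := qPoch_ne_zero_of_norm_lt hq hq n
      have e2 := one_sub_pow_ne_zero hq n
      have e3 : 1 - q * q ^ n ≠ 0 := by rwa [← pow_succ']
      simp only [eulerTerm, qPoch_succ, Nat.choose_succ_succ' n 1, Nat.choose_one_right]
      field_simp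
      ring
    simp only [this]
    simp [eulerTerm]
  rw [h1.tsum_sub h2, tsum_mul_left] at h3
  linear_combination h3

/-- Euler's identity `(z;q)_∞ = ∑ (-1)^n q^{n(n-1)/2} z^n / (q;q)_n`. -/
lemma qPochInf_eq_tsum (hq : ‖q‖ < 1) (z : ℂ) : qPochInf z q = ∑' n, eulerTerm q z n := by
  -- The functional equation is iterated `N` times; as `N → ∞` the remaining series tends to its
  -- value `1` at the origin.
  have h : ∀ N, ∑' n, eulerTerm q z n = qPoch z q N * ∑' n, eulerTerm q (z * q ^ N) n := by
    intro N
    induction N with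
    | zero => simp
    | succ N ih =>
      rw [ih, qPoch_succ, tsum_eulerTerm_eq_mul hq (z * q ^ N)]
      ring_nf
  have h0 : ∑' n, eulerTerm q 0 n = 1 := by
    rw [tsum_eq_single 0 fun n hn => by simp [eulerTerm, hn]]
    simp [eulerTerm]
  have h1 : Tendsto (fun N : ℕ => z * q ^ N) atTop (𝓝 0) := by
    simpa using (tendsto_pow_atTop_nhds_zero_of_norm_lt_one hq).const_mul z
  have h2 := ((differentiable_tsum_eulerTerm hq).continuous.tendsto 0).comp h1
  have h3 := (tendsto_qPoch hq z).mul h2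
  rw [h0, mul_one] at h3
  refine tendsto_nhds_unique h3 (tendsto_const_nhds.congr fun N => h N)

/-- Euler's series converges locally uniformly, unlike the product, whose holomorphy is not
available directly from its definition. -/
lemma differentiable_qPochInf (hq : ‖q‖ < 1) : Differentiable ℂ fun z => qPochInf z q := by
  simpa only [qPochInf_eq_tsum hq] using differentiable_tsum_eulerTerm hq

lemma qPochInf_zero : qPochInf (0 : ℂ) q = 1 := by
  simp [qPochInf]

lemma tendsto_qPochInf_mul_pow (hq : ‖q‖ < 1) (z : ℂ) :
    Tendsto (fun n : ℕ => qPochInf (z * q ^ n) q) atTop (𝓝 1) := by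
  have h1 : Tendsto (fun N : ℕ => z * q ^ N) atTop (𝓝 0) := by
    simpa using (tendsto_pow_atTop_nhds_zero_of_norm_lt_one hq).const_mul z
  have h2 := ((differentiable_qPochInf hq).continuous.tendsto 0).comp h1
  rwa [qPochInf_zero] at h2

/-- Euler's identity `∑ z^n / (q;q)_n = 1 / (z;q)_∞`. -/
lemma hasSum_pow_div_qPoch (hq : ‖q‖ < 1) {z : ℂ} (hz : ‖z‖ < 1) :
    HasSum (fun n => z ^ n / qPoch q q n) (qPochInf z q)⁻¹ := by
  obtain ⟨C, hC⟩ := exists_norm_inv_qPoch_le hq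
  have hC0 : 0 ≤ C := (norm_nonneg _).trans (hC 0)
  have hb : ∀ w : ℂ, ‖w‖ ≤ ‖z‖ → ∀ n, ‖w ^ n / qPoch q q n‖ ≤ ‖z‖ ^ n * C := fun w hw n => by
    rw [div_eq_mul_inv, norm_mul, norm_pow]
    exact mul_le_mul (by gcongr) (hC n) (norm_nonneg _) (by positivity)
  have hu : Summable fun n : ℕ => ‖z‖ ^ n * C :=
    (summable_geometric_of_lt_one (norm_nonneg z) hz).mul_right C
  have hs : ∀ w : ℂ, ‖w‖ ≤ ‖z‖ → Summable fun n => w ^ n / qPoch q q n := fun w hw =>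
    hu.of_norm_bounded (hb w hw)
  have hstep : ∀ w : ℂ, ‖w‖ ≤ ‖z‖ → ∑' n, (q * w) ^ n / qPoch q q n
      = (1 - w) * ∑' n, w ^ n / qPoch q q n := fun w hw => by
    have hw' : ‖q * w‖ ≤ ‖z‖ := by
      rw [norm_mul]; exact (mul_le_of_le_one_left (norm_nonneg _) hq.le).trans hw
    have h3 : ∑' n, (w ^ n / qPoch q q n - (q * w) ^ n / qPoch q q n)
        = ∑' n, w * (w ^ n / qPoch q q n) := by
      rw [((hs w hw).sub (hs _ hw')).tsum_eq_zero_add]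
      have : ∀ n, w ^ (n + 1) / qPoch q q (n + 1) - (q * w) ^ (n + 1) / qPoch q q (n + 1)
          = w * (w ^ n / qPoch q q n) := fun n => by
        have e1 := qPoch_ne_zero_of_norm_lt hq hq n
        have e3 : 1 - q * q ^ n ≠ 0 := by rw [← pow_succ']; exact one_sub_pow_ne_zero hq n
        simp only [qPoch_succ]
        field_simp
        ring
      simp [this]
    rw [(hs w hw).tsum_sub (hs _ hw'), tsum_mul_left] at h3
    linear_combination -h3
  have hle : ∀ N : ℕ, ‖z * q ^ N‖ ≤ ‖z‖ := fun N => by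
    rw [norm_mul, norm_pow]
    exact mul_le_of_le_one_right (norm_nonneg _) (pow_le_one₀ (norm_nonneg _) hq.le)
  have hN : ∀ N : ℕ, ∑' n, (z * q ^ N) ^ n / qPoch q q n
      = qPoch z q N * ∑' n, z ^ n / qPoch q q n := by
    intro N
    induction N with
    | zero => simp
    | succ N ih =>
      have : z * q ^ (N + 1) = q * (z * q ^ N) := by ring
      rw [this, hstep _ (hle N), ih, qPoch_succ]
      ring
  have h1 : Tendsto (fun N : ℕ => z * q ^ N) atTop (𝓝 0) := by
    simpa using (tendsto_pow_atTop_nhds_zero_of_norm_lt_one hq).const_mul z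
  have h2 : Tendsto (fun N : ℕ => ∑' n, (z * q ^ N) ^ n / qPoch q q n) atTop
      (𝓝 (∑' n, (0 : ℂ) ^ n / qPoch q q n)) :=
    tendsto_tsum_of_dominated_convergence hu (fun n => ((h1.pow n).div_const _))
      (Eventually.of_forall fun N n => hb _ (hle N) n)
  have h0 : ∑' n, (0 : ℂ) ^ n / qPoch q q n = 1 := by
    rw [tsum_eq_single 0 fun n hn => by simp [hn]]
    simp
  simp only [hN, h0] at h2
  have h3 := tendsto_nhds_unique h2 ((tendsto_qPoch hq z).mul_const _)
  have h4 := (hs z le_rfl).hasSum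
  rwa [eq_inv_of_mul_eq_one_right h3.symm] at h4

end QSeries

/-! ### Contiguous relations for `(b;q)_∞ ₁φ₁(a;b;q,z)` -/

section Contiguous

variable {q : ℂ}

lemma eulerTerm_succ (hq : ‖q‖ < 1) (z : ℂ) (n : ℕ) :
    eulerTerm q z (n + 1) * (1 - q ^ (n + 1)) = -z * q ^ n * eulerTerm q z n := by
  have e1 := qPoch_ne_zero_of_norm_lt hq hq n
  have e3 : 1 - q * q ^ n ≠ 0 := by rw [← pow_succ']; exact one_sub_pow_ne_zero hq n
  simp only [eulerTerm, qPoch_succ, Nat.choose_succ_succ' n 1, Nat.choose_one_right]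
  field_simp
  ring

lemma eulerTerm_mul (z : ℂ) (n : ℕ) : eulerTerm q (q * z) n = q ^ n * eulerTerm q z n := by
  simp only [eulerTerm, mul_pow]; ring

lemma regPhi11_eq (a b z : ℂ) :
    regPhi11 q a b z = ∑' n, qPoch a q n * qPochInf (b * q ^ n) q * eulerTerm q z n :=
  tsum_congr fun n => by rw [eulerTerm]; ring

lemma exists_norm_qPochInf_le (hq : ‖q‖ < 1) (b : ℂ) : ∃ C, ∀ n : ℕ,
    ‖qPochInf (b * q ^ n) q‖ ≤ C := by
  obtain ⟨C, hC⟩ := (tendsto_qPochInf_mul_pow hq b).norm.bddAbove_range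
  exact ⟨C, fun n => hC ⟨n, rfl⟩⟩

lemma summable_regPhi11 (hq : ‖q‖ < 1) (a b z : ℂ) :
    Summable fun n => qPoch a q n * qPochInf (b * q ^ n) q * eulerTerm q z n := by
  obtain ⟨C, hC⟩ := exists_norm_qPoch_le hq a
  obtain ⟨C', hC'⟩ := exists_norm_qPochInf_le hq b
  refine ((summable_eulerTerm hq z).norm.mul_left (C * C')).of_norm_bounded fun n => ?_
  rw [norm_mul, norm_mul]
  have := hC n
  have := hC' n
  have : 0 ≤ C := (norm_nonneg _).trans (hC 0)
  gcongr

lemma hasSum_regPhi11 (hq : ‖q‖ < 1) (a b z : ℂ) :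
    HasSum (fun n => qPoch a q n * qPochInf (b * q ^ n) q * eulerTerm q z n)
      (regPhi11 q a b z) := by
  rw [regPhi11_eq]; exact (summable_regPhi11 hq a b z).hasSum

lemma qPochInf_mul_pow (hq : ‖q‖ < 1) (b : ℂ) (n : ℕ) :
    qPochInf (b * q ^ n) q = (1 - b * q ^ n) * qPochInf (q * b * q ^ n) q := by
  rw [qPochInf_eq_mul hq, mul_assoc q]

/-- Some of the contiguous relations below hold term by term only after shifting the index of an
auxiliary series. If its zeroth term vanishes, the shift does not change the sum. -/
lemma hasSum_sub_succ {F : ℕ → ℂ} {x : ℂ} (hF : HasSum F x) (h0 : F 0 = 0) :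
    HasSum (fun n => F (n + 1)) x := by
  simpa [h0] using (hasSum_nat_add_iff' (f := F) 1).2 hF

lemma regPhi11_lowering (hq : ‖q‖ < 1) (a s X : ℂ) :
    s * (1 - X) * (1 - a * X) * regPhi11 q (q * X) (q * (s * X)) (q * (a * s * X))
      = regPhi11 q X (s * X) (a * s * X)
        + (s - 1) * regPhi11 q X (q * (s * X)) (q * (a * s * X)) := by
  have h1 := hasSum_regPhi11 hq (q * X) (q * (s * X)) (q * (a * s * X))
  have h2 := hasSum_regPhi11 hq X (s * X) (a * s * X)
  have h3 := hasSum_regPhi11 hq X (q * (s * X)) (q * (a * s * X))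
  -- The factor `1 - q^n` kills the zeroth term, so this series and its shift have the same sum.
  -- Subtracting them adds a telescoping zero that makes the identity true for each `n`.
  obtain ⟨g, hg⟩ : Summable fun n => qPoch X q n * qPochInf (s * X * q ^ n) q
      * eulerTerm q (a * s * X) n * (1 - q ^ n) := by
    have := (summable_regPhi11 hq X (s * X) (a * s * X)).sub
      (summable_regPhi11 hq X (s * X) (q * (a * s * X)))
    refine this.congr fun n => ?_
    rw [eulerTerm_mul]; ring
  have hg' := hasSum_sub_succ hg (by simp)
  refine ((h1.mul_left _).unique ((h2.add (h3.mul_left (s - 1))).sub (hg.sub hg')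
    |>.congr_fun fun n => ?_)).trans (by ring)
  have e1 : (1 - X) * qPoch (q * X) q n = qPoch X q n * (1 - X * q ^ n) := by
    rw [← qPoch_succ, qPoch_succ']
  have e2 := eulerTerm_succ hq (a * s * X) n
  have e3 := qPochInf_mul_pow hq (s * X) n
  have e4 : s * X * q ^ (n + 1) = q * (s * X) * q ^ n := by ring
  simp only [eulerTerm_mul, e4, qPoch_succ]
  rw [e3]
  linear_combination (s * (1 - a * X) * qPochInf (q * (s * X) * q ^ n) q * q ^ n
      * eulerTerm q (a * s * X) n) * e1
    - (qPoch X q n * (1 - X * q ^ n) * qPochInf (q * (s * X) * q ^ n) q) * e2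

lemma regPhi11_raising (hq : ‖q‖ < 1) (a s y : ℂ) :
    regPhi11 q y (s * y) (a * s * y)
        - a * s * y ^ 2 * regPhi11 q (q * y) (q * (s * y)) (q * (a * s * y))
      = regPhi11 q (q * y) (s * y) (a * s * y) := by
  have h1 := hasSum_regPhi11 hq (q * y) (q * (s * y)) (q * (a * s * y))
  have h2 := hasSum_regPhi11 hq y (s * y) (a * s * y)
  have h3 := hasSum_regPhi11 hq (q * y) (s * y) (a * s * y)
  have hg := hasSum_sub_succ (h2.sub h3) (by simp)
  have h4 := hg.unique ((h1.mul_left (a * s * y ^ 2)).congr_fun fun n => ?_)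
  · linear_combination h4
  have e2 := eulerTerm_succ hq (a * s * y) n
  have e4 : s * y * q ^ (n + 1) = q * (s * y) * q ^ n := by ring
  rw [e4, eulerTerm_mul, qPoch_succ' y, qPoch_succ (q * y)]
  linear_combination (-y * qPoch (q * y) q n * qPochInf (q * (s * y) * q ^ n) q) * e2

lemma regPhi11_lowering' (hq : ‖q‖ < 1) (y β z : ℂ) :
    (1 - z * y) * regPhi11 q (q * (y * β)) β z + z * y * regPhi11 q (q * (y * β)) (q * β) z
      = regPhi11 q (y * β) β z := by
  have h1 := hasSum_regPhi11 hq (q * (y * β)) β z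
  have h2 := hasSum_regPhi11 hq (q * (y * β)) (q * β) z
  have h3 := hasSum_regPhi11 hq (y * β) β z
  have hg := hasSum_sub_succ (h1.sub h3) (by simp)
  have h4 := hg.unique (((h1.sub h2).mul_left (z * y)).congr_fun fun n => ?_)
  · linear_combination h4
  have e2 := eulerTerm_succ hq z n
  have e4 : β * q ^ (n + 1) = q * β * q ^ n := by ring
  rw [e4, qPoch_succ' (y * β), qPoch_succ (q * (y * β)), qPochInf_mul_pow hq β]
  linear_combination (y * β * qPoch (q * (y * β)) q n * qPochInf (q * β * q ^ n) q) * e2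

lemma regPhi11_raising' (hq : ‖q‖ < 1) (y β z : ℂ) :
    (1 - y) * regPhi11 q (y * β) (q * β) z + y * regPhi11 q (y * β) β z
      = (1 - y * β) * regPhi11 q (q * (y * β)) (q * β) z := by
  have h1 := hasSum_regPhi11 hq (y * β) (q * β) z
  have h2 := hasSum_regPhi11 hq (y * β) β z
  have h3 := hasSum_regPhi11 hq (q * (y * β)) (q * β) z
  refine ((h1.mul_left _).add (h2.mul_left _)).unique ((h3.mul_left _).congr_fun fun n => ?_)
  have e1 : (1 - y * β) * qPoch (q * (y * β)) q n = qPoch (y * β) q n * (1 - y * β * q ^ n) := by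
    rw [← qPoch_succ, qPoch_succ']
  rw [qPochInf_mul_pow hq β]
  linear_combination (-qPochInf (q * β * q ^ n) q * eulerTerm q z n) * e1

end Contiguous

/-! ### Lowering and raising relations for the eigenfunctions -/

/-- The standing assumptions on the parameters. -/
structure Admissible (q c d : ℝ) : Prop where
  q_pos : 0 < q
  q_lt : q < 1
  c_pos : 0 < c
  d_pos : 0 < d
  lt : q * c < d

section Eigenfunctions

variable {q c d : ℝ}

lemma Admissible.norm_lt (h : Admissible q c d) : ‖(q : ℂ)‖ < 1 := by
  simpa [abs_of_pos h.q_pos] using h.q_lt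

lemma Admissible.q_ne (h : Admissible q c d) : (q : ℂ) ≠ 0 := by
  exact_mod_cast h.q_pos.ne'

lemma Admissible.c_ne (h : Admissible q c d) : (c : ℂ) ≠ 0 := by
  exact_mod_cast h.c_pos.ne'

lemma Admissible.d_ne (h : Admissible q c d) : (d : ℂ) ≠ 0 := by
  exact_mod_cast h.d_pos.ne'

lemma Admissible.mul_pow_lt (h : Admissible q c d) (k : ℕ) : c * q ^ (k + 1) / d < 1 := by
  rw [div_lt_one h.d_pos, pow_succ]
  have h1 : q ^ k ≤ 1 := pow_le_one₀ h.q_pos.le h.q_lt.le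
  have h2 := h.lt
  have h3 := mul_pos h.c_pos h.q_pos
  nlinarith

lemma Admissible.mul_pow_pos (h : Admissible q c d) (k : ℕ) : 0 < c * q ^ (k + 1) / d := by
  have h1 := h.q_pos
  have h2 := h.c_pos
  have h3 := h.d_pos
  positivity

lemma Admissible.norm_mul_pow_lt (h : Admissible q c d) (k : ℕ) :
    ‖(c : ℂ) * q ^ (k + 1) / d‖ < 1 := by
  have : (c : ℂ) * q ^ (k + 1) / d = ((c * q ^ (k + 1) / d : ℝ) : ℂ) := by push_cast; rfl
  rw [this, Complex.norm_real, Real.norm_eq_abs, abs_of_pos (h.mul_pow_pos k)]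
  exact h.mul_pow_lt k

lemma Admissible.norm_pow_lt (h : Admissible q c d) (k : ℕ) : ‖(q : ℂ) ^ (k + 1)‖ < 1 := by
  rw [norm_pow]; exact pow_lt_one₀ (norm_nonneg _) h.norm_lt (by simp)

lemma Admissible.pochC_ne (h : Admissible q c d) (k : ℕ) :
    qPochInf ((c : ℂ) * q ^ (k + 1) / d) (q : ℂ) ≠ 0 :=
  qPochInf_ne_zero h.norm_lt (h.norm_mul_pow_lt k)

lemma Admissible.pochQ_ne (h : Admissible q c d) (k : ℕ) :
    qPochInf ((q : ℂ) ^ (k + 1)) (q : ℂ) ≠ 0 :=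
  qPochInf_ne_zero h.norm_lt (h.norm_pow_lt k)

lemma Admissible.pochC_eq (h : Admissible q c d) (k : ℕ) :
    qPochInf ((c : ℂ) * q ^ (k + 1) / d) (q : ℂ)
      = (1 - c / d * q ^ (k + 1)) * qPochInf ((c : ℂ) * q ^ (k + 2) / d) (q : ℂ) := by
  rw [qPochInf_eq_mul h.norm_lt]
  ring_nf

lemma Admissible.pochQ_eq (h : Admissible q c d) (k : ℕ) :
    qPochInf ((q : ℂ) ^ (k + 1)) (q : ℂ)
      = (1 - q ^ (k + 1)) * qPochInf ((q : ℂ) ^ (k + 2)) (q : ℂ) := by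
  rw [qPochInf_eq_mul h.norm_lt]
  ring_nf

lemma coeffA_pt (h : Admissible q c d) (k : ℕ) :
    coeffA c d (pt q c k) = (1 - q ^ k) * (1 - c / d * q ^ k) := by
  have := h.q_pos.ne'
  have := h.c_pos.ne'
  have := h.d_pos.ne'
  simp only [coeffA, pt]
  field_simp

lemma coeffB_pt (h : Admissible q c d) (k : ℕ) :
    coeffB q c d (pt q c k) = c / d * q ^ (2 * k + 1) := by
  have := h.q_pos.ne'
  have := h.c_pos.ne'
  have := h.d_pos.ne'
  simp only [coeffB, pt]
  field_simp
  ring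

lemma opL_succ (h : Admissible q c d) (f : ℕ → ℂ) (k : ℕ) :
    opL q c d f (k + 1) = (1 - (q : ℂ) ^ (k + 1)) * (1 - c / d * q ^ (k + 1)) * (f k - f (k + 1))
      + c / d * q ^ (2 * k + 3) * (f (k + 2) - f (k + 1)) := by
  simp only [opL, coeffA_pt h, coeffB_pt h]
  push_cast
  ring

lemma opL_zero (h : Admissible q c d) (f : ℕ → ℂ) :
    opL q c d f 0 = c / d * q * (f 1 - f 0) := by
  simp only [opL, coeffB_pt h]
  push_cast
  ring

/-- `L` is, up to sign, the raising operator after the lowering one: expressing both differences in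
`L` through `g` turns `q^{k+1} Lf` into `-l` times the left side of the raising relation. In the
applications `g` is the eigenfunction with parameter `γ/q`. -/
lemma opL_succ_of_lowering_raising (h : Admissible q c d) {f g : ℕ → ℂ} {l r : ℂ} {k : ℕ}
    (h1 : (q : ℂ) ^ (k + 1) * (f (k + 1) - f k) = l * g k)
    (h2 : (q : ℂ) ^ (k + 2) * (f (k + 2) - f (k + 1)) = l * g (k + 1))
    (h3 : (1 - (q : ℂ) ^ (k + 1)) * (1 - c / d * q ^ (k + 1)) * g k
      - c / d * (q ^ (k + 1)) ^ 2 * g (k + 1) = r * q ^ (k + 1) * f (k + 1)) :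
    opL q c d f (k + 1) = -(l * r) * f (k + 1) := by
  have hq : (q : ℂ) ^ (k + 1) ≠ 0 := pow_ne_zero _ h.q_ne
  apply mul_left_cancel₀ hq
  rw [opL_succ h]
  linear_combination (-(1 - (q : ℂ) ^ (k + 1)) * (1 - c / d * q ^ (k + 1))) * h1
    + c / d * (q ^ (k + 1)) ^ 2 * h2 - l * h3

/-! ### The functions `φ_γ` -/

lemma eigPhi_lowering (h : Admissible q c d) {γ : ℂ} (hγ : γ ≠ 0) (k : ℕ) :
    (q : ℂ) ^ (k + 1) * (eigPhi q c d γ (k + 1) - eigPhi q c d γ k)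
      = q / γ * eigPhi q c d (γ / q) k := by
  have hq := h.q_ne
  have hd := h.d_ne
  have n1 := h.pochC_ne (k + 1)
  have n2 := h.pochQ_ne (k + 1)
  have n3 := h.pochC_ne k
  have n4 := h.pochQ_ne k
  have e := regPhi11_lowering h.norm_lt ((c : ℂ) / d) γ⁻¹ ((q : ℂ) ^ (k + 1))
  simp only [eigPhi]
  rw [show (q : ℂ) ^ (k + 1 + 1) = q * q ^ (k + 1) by ring,
    show (q : ℂ) * q ^ (k + 1) / γ = q * (γ⁻¹ * q ^ (k + 1)) by ring,
    show (c : ℂ) * (q * q ^ (k + 1)) / (d * γ) = q * (c / d * γ⁻¹ * q ^ (k + 1)) by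
      field_simp,
    show (q : ℂ) ^ (k + 1) / γ = γ⁻¹ * q ^ (k + 1) by ring,
    show (c : ℂ) * q ^ (k + 1) / (d * γ) = c / d * γ⁻¹ * q ^ (k + 1) by field_simp,
    show (q : ℂ) ^ (k + 1) / (γ / q) = q * (γ⁻¹ * q ^ (k + 1)) by field_simp,
    show (c : ℂ) * q ^ (k + 1) / (d * (γ / q)) = q * (c / d * γ⁻¹ * q ^ (k + 1)) by
      field_simp,
    show (q : ℂ) * (γ / q) = γ by field_simp, qPochInf_eq_mul h.norm_lt γ]
  have p1 := h.pochC_eq k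
  have p2 := h.pochQ_eq k
  rw [show k + 2 = k + 1 + 1 by ring] at p1 p2
  rw [show (q : ℂ) ^ (k + 1 + 1) = q * q ^ (k + 1) by ring] at n1 n2 p1 p2
  have m1 : (1 - (c : ℂ) / d * q ^ (k + 1)) ≠ 0 := fun h0 => n3 (by rw [p1, h0, zero_mul])
  have m2 : (1 - (q : ℂ) ^ (k + 1)) ≠ 0 := fun h0 => n4 (by rw [p2, h0, zero_mul])
  rw [p1, p2]
  have : γ ^ (k + 1) ≠ 0 := pow_ne_zero _ hγ
  generalize regPhi11 (q : ℂ) (q * q ^ (k + 1)) _ _ = R1 at *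
  generalize regPhi11 (q : ℂ) (q ^ (k + 1)) (γ⁻¹ * q ^ (k + 1)) _ = R2 at *
  generalize regPhi11 (q : ℂ) (q ^ (k + 1)) (q * (γ⁻¹ * q ^ (k + 1))) _ = R3 at *
  generalize qPochInf ((q : ℂ) * q ^ (k + 1)) _ = Q1 at *
  generalize qPochInf ((c : ℂ) * (q * q ^ (k + 1)) / d) _ = Q2 at *
  generalize qPochInf ((q : ℂ) * γ) _ = Q3 at *
  generalize 1 - (c : ℂ) / d * q ^ (k + 1) = M at e m1 ⊢
  have key : (q : ℂ) ^ (k + 1) * (Q3 * (γ ^ (k + 1))⁻¹ / (Q1 * Q2) * R1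
      - Q3 * (γ ^ k)⁻¹ / ((1 - q ^ (k + 1)) * Q1 * (M * Q2)) * R2)
      = q ^ (k + 1) * Q3 * (γ ^ k)⁻¹ /
        ((1 - q ^ (k + 1)) * Q1 * (M * Q2))
        * (γ⁻¹ * (1 - q ^ (k + 1)) * M * R1 - R2) := by
    rw [pow_succ γ k, mul_inv]
    field_simp
  rw [key, e, div_pow]
  field_simp
  ring

lemma eigPhi_raising (h : Admissible q c d) {γ : ℂ} (hγ : γ ≠ 0) (k : ℕ) :
    (1 - (q : ℂ) ^ (k + 1)) * (1 - c / d * q ^ (k + 1)) * eigPhi q c d γ k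
      - c / d * (q ^ (k + 1)) ^ 2 * eigPhi q c d γ (k + 1)
      = γ * (1 - q * γ) * q ^ (k + 1) * eigPhi q c d (q * γ) (k + 1) := by
  have hq := h.q_ne
  have hd := h.d_ne
  have n1 := h.pochC_ne (k + 1)
  have n2 := h.pochQ_ne (k + 1)
  have n3 := h.pochC_ne k
  have n4 := h.pochQ_ne k
  have e := regPhi11_raising h.norm_lt ((c : ℂ) / d) γ⁻¹ ((q : ℂ) ^ (k + 1))
  simp only [eigPhi]
  rw [show (q : ℂ) ^ (k + 1 + 1) = q * q ^ (k + 1) by ring,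
    show (q : ℂ) * q ^ (k + 1) / γ = q * (γ⁻¹ * q ^ (k + 1)) by ring,
    show (c : ℂ) * (q * q ^ (k + 1)) / (d * γ) = q * (c / d * γ⁻¹ * q ^ (k + 1)) by
      field_simp,
    show (q : ℂ) ^ (k + 1) / γ = γ⁻¹ * q ^ (k + 1) by ring,
    show (c : ℂ) * q ^ (k + 1) / (d * γ) = c / d * γ⁻¹ * q ^ (k + 1) by field_simp,
    show (q : ℂ) * q ^ (k + 1) / (q * γ) = γ⁻¹ * q ^ (k + 1) by field_simp,
    show (c : ℂ) * (q * q ^ (k + 1)) / (d * (q * γ)) = c / d * γ⁻¹ * q ^ (k + 1) by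
      field_simp,
    qPochInf_eq_mul h.norm_lt (q * γ)]
  have p1 := h.pochC_eq k
  have p2 := h.pochQ_eq k
  rw [show k + 2 = k + 1 + 1 by ring] at p1 p2
  rw [show (q : ℂ) ^ (k + 1 + 1) = q * q ^ (k + 1) by ring] at n1 n2 p1 p2
  have m1 : (1 - (c : ℂ) / d * q ^ (k + 1)) ≠ 0 := fun h0 => n3 (by rw [p1, h0, zero_mul])
  have m2 : (1 - (q : ℂ) ^ (k + 1)) ≠ 0 := fun h0 => n4 (by rw [p2, h0, zero_mul])
  rw [p1, p2, ← e]
  have : γ ^ (k + 1) ≠ 0 := pow_ne_zero _ hγ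
  generalize regPhi11 (q : ℂ) (q * q ^ (k + 1)) (q * (γ⁻¹ * q ^ (k + 1))) _ = R1 at *
  generalize regPhi11 (q : ℂ) (q ^ (k + 1)) (γ⁻¹ * q ^ (k + 1)) _ = R2 at *
  generalize qPochInf ((q : ℂ) * q ^ (k + 1)) _ = Q1 at *
  generalize qPochInf ((c : ℂ) * (q * q ^ (k + 1)) / d) _ = Q2 at *
  generalize qPochInf ((q : ℂ) * (q * γ)) _ = Q3 at *
  generalize 1 - (c : ℂ) / d * q ^ (k + 1) = M at m1 ⊢
  have key : (1 - (q : ℂ) ^ (k + 1)) * M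
      * ((1 - q * γ) * Q3 * (γ ^ k)⁻¹
        / ((1 - q ^ (k + 1)) * Q1 * (M * Q2)) * R2)
      = (1 - q * γ) * Q3 * (γ ^ k)⁻¹ / (Q1 * Q2) * R2 := by
    field_simp
  rw [key, mul_pow, mul_inv, pow_succ γ k, mul_inv]
  field_simp

lemma eigPhi_opL_succ (h : Admissible q c d) {γ : ℂ} (hγ : γ ≠ 0) (k : ℕ) :
    opL q c d (eigPhi q c d γ) (k + 1) = (γ - 1) * eigPhi q c d γ (k + 1) := by
  have hq := h.q_ne
  have h3 := eigPhi_raising h (div_ne_zero hγ hq) k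
  rw [show (q : ℂ) * (γ / q) = γ by field_simp] at h3
  rw [opL_succ_of_lowering_raising h (eigPhi_lowering h hγ k) (eigPhi_lowering h hγ (k + 1)) h3]
  field_simp
  ring

lemma regPhi11_one (s z : ℂ) {q : ℂ} : regPhi11 q 1 s z = qPochInf s q := by
  rw [regPhi11_eq, tsum_eq_single 0 fun n hn => ?_]
  · simp [eulerTerm]
  · obtain ⟨m, rfl⟩ := Nat.exists_eq_succ_of_ne_zero hn
    simp [qPoch_succ']

lemma regPhi11_self {q : ℂ} (hq : ‖q‖ < 1) (b z : ℂ) :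
    regPhi11 q b b z = qPochInf b q * qPochInf z q := by
  rw [regPhi11_eq, qPochInf_eq_tsum hq z, ← tsum_mul_left]
  exact tsum_congr fun n => by rw [← qPochInf_eq_qPoch_mul hq]

/-- At `k = 0` the raising identity is used with `y = 1`, where `₁φ₁` has numerator parameter `1`
and reduces to a single product. That product is the defect, a multiple of `θ(γ;q)`. -/
lemma eigPhi_opL_zero (h : Admissible q c d) {γ : ℂ} (hγ : γ ≠ 0) :
    opL q c d (eigPhi q c d γ) 0 = (γ - 1) * eigPhi q c d γ 0
      + qPochInf γ (q : ℂ) * qPochInf (q / γ) (q : ℂ)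
        / (qPochInf (q : ℂ) (q : ℂ) * qPochInf ((c : ℂ) * q / d) (q : ℂ)) := by
  have hq := h.q_ne
  have hd := h.d_ne
  have n1 := h.pochC_ne 0
  have n2 := h.pochQ_ne 0
  have e := regPhi11_raising h.norm_lt ((c : ℂ) / d) (q / γ) 1
  have l := eigPhi_lowering h hγ 0
  rw [zero_add, pow_one] at l n1 n2
  rw [opL_zero h, mul_assoc, l]
  simp only [eigPhi, zero_add, pow_one, pow_zero, inv_one, mul_one]
  rw [regPhi11_one] at e
  simp only [mul_one, one_pow] at e
  rw [show (q : ℂ) * (γ / q) = γ by field_simp,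
    show (c : ℂ) * q / (d * γ) = c / d * (q / γ) by field_simp,
    show (c : ℂ) * q / (d * (γ / q)) = q * (c / d * (q / γ)) by field_simp,
    show (q : ℂ) / (γ / q) = q * (q / γ) by field_simp, ← e, qPochInf_eq_mul h.norm_lt γ]
  field_simp
  ring

/-! ### The functions `Ψ_γ` -/

lemma eigPsi_lowering (h : Admissible q c d) (γ : ℂ) (k : ℕ) :
    (q : ℂ) ^ (k + 1) * (eigPsi q c d γ (k + 1) - eigPsi q c d γ k)
      = -(d / c) * eigPsi q c d (γ / q) k := by
  have hq := h.q_ne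
  have hd := h.d_ne
  have hc := h.c_ne
  have n1 := h.pochC_ne (k + 1)
  have n3 := h.pochC_ne k
  have hqk : (q : ℂ) ^ k ≠ 0 := pow_ne_zero _ hq
  have e := regPhi11_lowering' h.norm_lt ((q : ℂ) ^ k) (γ / q ^ k) (c * q / d)
  rw [show (q : ℂ) ^ k * (γ / q ^ k) = γ by field_simp] at e
  simp only [eigPsi]
  rw [show γ * q / (q : ℂ) ^ (k + 1) = γ / q ^ k by rw [pow_succ]; field_simp,
    show (q : ℂ) * (γ / q) = γ by field_simp, show γ / q * q / (q : ℂ) ^ k = γ / q ^ k by field_simp,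
    show γ * q / (q : ℂ) ^ k = q * (γ / q ^ k) by ring, ← e]
  have p1 := h.pochC_eq k
  rw [show k + 2 = k + 1 + 1 by ring] at p1
  have m1 : (1 - (c : ℂ) / d * q ^ (k + 1)) ≠ 0 := fun h0 => n3 (by rw [p1, h0, zero_mul])
  rw [p1, Nat.choose_succ_succ' (k + 1) 1, Nat.choose_one_right, pow_add (q : ℂ) (k + 1) ((k + 1).choose (1 + 1)), pow_succ (-(d : ℂ) / c)]
  have hz : (c : ℂ) * q / d * q ^ k = c / d * q ^ (k + 1) := by ring
  rw [hz]
  generalize regPhi11 (q : ℂ) (q * γ) (γ / q ^ k) _ = R1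
  generalize regPhi11 (q : ℂ) (q * γ) (q * (γ / q ^ k)) _ = R2
  generalize qPochInf ((c : ℂ) * q ^ (k + 1 + 1) / d) _ = Q at n1 ⊢
  generalize 1 - (c : ℂ) / d * q ^ (k + 1) = M at m1 ⊢
  have hcd : (c : ℂ) / d * (d / c) = 1 := by field_simp
  rw [show -(d : ℂ) / c = -(d / c) by ring]
  generalize (c : ℂ) / d = a at hcd ⊢
  generalize (d : ℂ) / c = a' at hcd ⊢
  have ha : a ≠ 0 := left_ne_zero_of_mul (hcd ▸ one_ne_zero)
  obtain rfl : a' = a⁻¹ := eq_inv_of_mul_eq_one_right hcd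
  have hX : (q : ℂ) ^ (k + 1) ≠ 0 := pow_ne_zero _ hq
  generalize (q : ℂ) ^ (k + 1) = X at hX ⊢
  field_simp
  ring

lemma eigPsi_raising (h : Admissible q c d) (γ : ℂ) (k : ℕ) :
    (1 - (q : ℂ) ^ (k + 1)) * (1 - c / d * q ^ (k + 1)) * eigPsi q c d γ k
      - c / d * (q ^ (k + 1)) ^ 2 * eigPsi q c d γ (k + 1)
      = -(c / d) * (1 - q * γ) * q ^ (k + 1) * eigPsi q c d (q * γ) (k + 1) := by
  have hq := h.q_ne
  have hd := h.d_ne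
  have hc := h.c_ne
  have n1 := h.pochC_ne (k + 1)
  have n3 := h.pochC_ne k
  have hqk : (q : ℂ) ^ (k + 1) ≠ 0 := pow_ne_zero _ hq
  have e := regPhi11_raising' h.norm_lt ((q : ℂ) ^ (k + 1)) (γ * q / q ^ (k + 1)) (c * q / d)
  rw [show (q : ℂ) ^ (k + 1) * (γ * q / q ^ (k + 1)) = q * γ by field_simp] at e
  simp only [eigPsi]
  rw [show γ * q / (q : ℂ) ^ k = q * (γ * q / q ^ (k + 1)) by rw [pow_succ]; field_simp,
    show (q : ℂ) * γ * q / q ^ (k + 1) = q * (γ * q / q ^ (k + 1)) by ring]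
  have p1 := h.pochC_eq k
  rw [show k + 2 = k + 1 + 1 by ring] at p1
  have m1 : (1 - (c : ℂ) / d * q ^ (k + 1)) ≠ 0 := fun h0 => n3 (by rw [p1, h0, zero_mul])
  rw [p1, Nat.choose_succ_succ' (k + 1) 1, Nat.choose_one_right, pow_add (q : ℂ) (k + 1) ((k + 1).choose (1 + 1)), pow_succ (-(d : ℂ) / c)]
  generalize 1 - (c : ℂ) / d * q ^ (k + 1) = M at m1 ⊢
  have hcd : (c : ℂ) / d * (d / c) = 1 := by field_simp
  rw [show -(d : ℂ) / c = -(d / c) by ring]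
  generalize regPhi11 (q : ℂ) (q * (q * γ)) _ _ = R1 at e ⊢
  generalize regPhi11 (q : ℂ) (q * γ) (q * (γ * q / q ^ (k + 1))) _ = R2 at e ⊢
  generalize regPhi11 (q : ℂ) (q * γ) (γ * q / q ^ (k + 1)) _ = R3 at e ⊢
  generalize qPochInf ((c : ℂ) * q ^ (k + 1 + 1) / d) _ = Q at n1 ⊢
  generalize (c : ℂ) / d = a at hcd ⊢
  generalize (d : ℂ) / c = a' at hcd ⊢
  have ha : a ≠ 0 := left_ne_zero_of_mul (hcd ▸ one_ne_zero)
  obtain rfl : a' = a⁻¹ := eq_inv_of_mul_eq_one_right hcd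
  generalize (q : ℂ) ^ (k + 1) = X at hqk e ⊢
  field_simp
  linear_combination (-a⁻¹) ^ k * e

lemma eigPsi_opL_succ (h : Admissible q c d) (γ : ℂ) (k : ℕ) :
    opL q c d (eigPsi q c d γ) (k + 1) = (γ - 1) * eigPsi q c d γ (k + 1) := by
  have hq := h.q_ne
  have hc := h.c_ne
  have hd := h.d_ne
  have h3 := eigPsi_raising h (γ / q) k
  rw [show (q : ℂ) * (γ / q) = γ by field_simp] at h3
  rw [opL_succ_of_lowering_raising h (eigPsi_lowering h γ k) (eigPsi_lowering h γ (k + 1)) h3]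
  field_simp
  ring

/-- At `k = 0` the two parameters of `₁φ₁` coincide, so Euler's identity sums the series, and the
factor `(cq/d;q)_∞` cancels. -/
lemma eigPsi_zero (h : Admissible q c d) (γ : ℂ) :
    eigPsi q c d γ 0 = qPochInf (q * γ) (q : ℂ) := by
  have n1 := h.pochC_ne 0
  rw [zero_add, pow_one] at n1
  simp only [eigPsi, pow_zero, zero_add, pow_one, div_one]
  rw [mul_comm γ, regPhi11_self h.norm_lt]
  simp
  field_simp

lemma eigPsi_opL_zero (h : Admissible q c d) (γ : ℂ) :
    opL q c d (eigPsi q c d γ) 0 = (γ - 1) * eigPsi q c d γ 0 := by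
  have hq := h.q_ne
  have hc := h.c_ne
  have hd := h.d_ne
  have l := eigPsi_lowering h γ 0
  rw [zero_add, pow_one] at l
  rw [opL_zero h, mul_assoc, l, eigPsi_zero h, eigPsi_zero h,
    show (q : ℂ) * (γ / q) = γ by field_simp, qPochInf_eq_mul h.norm_lt γ]
  field_simp
  ring

/-- The function `x ↦ V_n^{(c/d)}(cx;q)` on `I_q`. -/
def seqV (q c d : ℝ) (n k : ℕ) : ℝ := polyV (c / d) q n (c * pt q c k)

/-! ### The Al-Salam–Carlitz polynomials and their identification with `φ_γ` at `γ = q^n` -/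

lemma real_one_sub_pow_ne_zero (hq0 : 0 < q) (hq1 : q < 1) (n : ℕ) : 1 - q ^ (n + 1) ≠ 0 :=
  (sub_pos.2 (pow_lt_one₀ hq0.le hq1 (by simp))).ne'

lemma real_qPoch_ne_zero (hq0 : 0 < q) (hq1 : q < 1) (n : ℕ) : qPoch q q n ≠ 0 := by
  rw [qPoch, Finset.prod_ne_zero_iff]
  intro i _
  rw [← pow_succ']
  exact real_one_sub_pow_ne_zero hq0 hq1 i

lemma polyV_succ_sub (hq0 : 0 < q) (hq1 : q < 1) {a : ℝ} (ha : a ≠ 0) (n : ℕ) (z : ℝ) :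
    polyV a q (n + 1) z - polyV a q (n + 1) (q * z)
      = z * (q ^ n)⁻¹ * (1 - q ^ (n + 1)) * polyV a q n (q * z) := by
  have hq := hq0.ne'
  have key : phi20 q (n + 1) z (q ^ (n + 1) / a) - phi20 q (n + 1) (q * z) (q ^ (n + 1) / a)
      = -z * (1 - q ^ (n + 1)) / a * phi20 q n (q * z) (q ^ n / a) := by
    -- The `k = 0` terms cancel, and the remaining terms match those of degree `n` after a shift of
    -- the summation index.
    rw [phi20, phi20, phi20, ← Finset.sum_sub_distrib, Finset.sum_range_succ', Finset.mul_sum]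
    simp only [qPoch_zero, sub_self, add_zero]
    refine Finset.sum_congr rfl fun j _ => ?_
    have e1 := real_qPoch_ne_zero hq0 hq1 j
    have e2 := real_one_sub_pow_ne_zero hq0 hq1 j
    have e3 : 1 - q * q ^ j ≠ 0 := by rwa [← pow_succ']
    rw [qPoch_succ' z, qPoch_succ (q * z), qPoch_succ' (q ^ (n + 1))⁻¹, qPoch_succ q,
      Nat.choose_succ_succ' j 1, Nat.choose_one_right,
      show q * (q ^ (n + 1))⁻¹ = (q ^ n)⁻¹ by rw [pow_succ]; field_simp, div_pow, div_pow]
    generalize qPoch (q ^ n)⁻¹ q j = P1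
    generalize qPoch (q * z) q j = P2
    generalize qPoch q q j = P3 at *
    field_simp
    ring
  rw [polyV, polyV, polyV, ← mul_sub, key, Nat.choose_succ_succ' n 1, Nat.choose_one_right]
  field_simp
  ring

lemma seqV_lowering (h : Admissible q c d) (n k : ℕ) :
    q ^ (k + 1) * (seqV q c d (n + 1) (k + 1) - seqV q c d (n + 1) k)
      = (q ^ n)⁻¹ * (1 - q ^ (n + 1)) * seqV q c d n k := by
  have hq := h.q_pos.ne'
  have hc := h.c_pos.ne'
  have e : c * pt q c k = q * (c * pt q c (k + 1)) := by
    simp only [pt]; rw [pow_succ]; field_simp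
  have e2 : q ^ (k + 1) * (c * pt q c (k + 1)) = 1 := by
    simp only [pt]; field_simp
  rw [seqV, seqV, seqV, e, polyV_succ_sub h.q_pos h.q_lt (div_pos h.c_pos h.d_pos).ne']
  linear_combination ((q ^ n)⁻¹ * (1 - q ^ (n + 1)) * polyV (c / d) q n (q * (c * pt q c (k + 1))))
    * e2

lemma seqV_at_zero (h : Admissible q c d) (n : ℕ) :
    seqV q c d n 0 = (-(c / d)) ^ n * (q ^ (n.choose 2))⁻¹ := by
  have hc := h.c_pos.ne'
  have e : c * pt q c 0 = 1 := by simp [pt]; field_simp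
  rw [seqV, e, polyV, phi20, Finset.sum_range_succ']
  simp [qPoch_succ']

lemma seqV_zero (k : ℕ) : seqV q c d 0 k = 1 := by
  simp [seqV, polyV, phi20]

/-- Lowering leads to `γ = 1/q`, where the prefactor `(qγ;q)_∞` is `(1;q)_∞ = 0`. -/
lemma eigPhi_one_succ (h : Admissible q c d) (k : ℕ) :
    eigPhi q c d 1 (k + 1) = eigPhi q c d 1 k := by
  have hq := h.q_ne
  have l := eigPhi_lowering h one_ne_zero k
  have e : eigPhi q c d (1 / q) k = 0 := by
    rw [eigPhi, show (q : ℂ) * (1 / q) = 1 by field_simp, qPochInf_eq_mul h.norm_lt]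
    simp
  rw [e, mul_zero, mul_eq_zero] at l
  exact sub_eq_zero.1 (l.resolve_left (pow_ne_zero _ hq))

/-- At `γ = q^{n+1}` the boundary defect vanishes. The boundary equation involves only `φ(1) -
φ(0)`, which lowering expresses by `φ_{q^n}(0)`; this gives a recursion in `n` for the values at
`1/c`. -/
lemma eigPhi_pow_succ_zero (h : Admissible q c d) (n : ℕ) :
    c / d * eigPhi q c d ((q : ℂ) ^ n) 0
      = q ^ n * (q ^ (n + 1) - 1) * eigPhi q c d ((q : ℂ) ^ (n + 1)) 0 := by
  have hq := h.q_ne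
  have hγ : (q : ℂ) ^ (n + 1) ≠ 0 := pow_ne_zero _ hq
  have l := eigPhi_lowering h hγ 0
  have e := eigPhi_opL_zero h hγ
  have hz : qPochInf ((q : ℂ) / q ^ (n + 1)) (q : ℂ) = 0 := by
    rw [qPochInf_eq_qPoch_mul h.norm_lt _ (n + 1), qPoch_succ]
    have : (q : ℂ) / q ^ (n + 1) * q ^ n = 1 := by rw [pow_succ]; field_simp
    rw [this]; simp
  rw [hz, mul_zero, zero_div, add_zero, opL_zero h] at e
  rw [zero_add, pow_one, show (q : ℂ) ^ (n + 1) / q = q ^ n by rw [pow_succ]; field_simp] at l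
  have l2 : eigPhi q c d ((q : ℂ) ^ (n + 1)) 1 - eigPhi q c d ((q : ℂ) ^ (n + 1)) 0
      = ((q : ℂ) ^ (n + 1))⁻¹ * eigPhi q c d ((q : ℂ) ^ n) 0 := by
    apply mul_left_cancel₀ hq
    rw [l]; ring
  rw [l2] at e
  rw [mul_assoc, ← e, pow_succ]
  field_simp

/-- `φ_{q^n}` is a multiple of the `n`-th Al-Salam--Carlitz polynomial. -/
lemma eigPhi_pow (h : Admissible q c d) (n k : ℕ) :
    eigPhi q c d ((q : ℂ) ^ n) k
      = qPochInf ((q : ℂ) ^ (n + 1)) (q : ℂ) * (seqV q c d n k : ℂ) := by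
  have hq := h.q_ne
  -- Both sides obey the same lowering relation, so agreement at `k = 0` propagates to all `k` by
  -- induction on `n` and then on `k`.
  have h0 : ∀ n : ℕ, eigPhi q c d ((q : ℂ) ^ n) 0
      = qPochInf ((q : ℂ) ^ (n + 1)) (q : ℂ) * (seqV q c d n 0 : ℂ) := fun n => by
    induction n with
    | zero =>
      have n1 := h.pochC_ne 0
      have n2 := h.pochQ_ne 0
      rw [zero_add, pow_one] at n1 n2
      simp only [eigPhi, seqV_zero, pow_zero, zero_add, pow_one, div_one, mul_one, inv_one,
        regPhi11_self h.norm_lt]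
      push_cast
      field_simp
    | succ n ih =>
      have e := eigPhi_pow_succ_zero h n
      have m : (q : ℂ) ^ (n + 1) - 1 ≠ 0 := by
        have := one_sub_pow_ne_zero h.norm_lt n
        rwa [← neg_sub, neg_ne_zero]
      have m2 : (q : ℂ) ^ n ≠ 0 := pow_ne_zero _ hq
      apply mul_left_cancel₀ (mul_ne_zero m2 m)
      rw [← e, ih, h.pochQ_eq n, seqV_at_zero h, seqV_at_zero h]
      push_cast
      rw [Nat.choose_succ_succ' n 1, Nat.choose_one_right]
      field_simp
      ring
  induction n generalizing k with
  | zero =>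
    induction k with
    | zero => exact h0 0
    | succ k ih =>
      rw [pow_zero, eigPhi_one_succ h, ← pow_zero (q : ℂ), ih]
      simp [seqV_zero]
  | succ n ihn =>
    induction k with
    | zero => exact h0 _
    | succ k ih =>
      have hγ : (q : ℂ) ^ (n + 1) ≠ 0 := pow_ne_zero _ hq
      have l := eigPhi_lowering h hγ k
      rw [ih, show (q : ℂ) ^ (n + 1) / q = q ^ n by rw [pow_succ]; field_simp, ihn] at l
      have l2 := congrArg (fun x : ℝ => (x : ℂ)) (seqV_lowering h n k)
      push_cast at l2
      have m : (q : ℂ) ^ (k + 1) ≠ 0 := pow_ne_zero _ hq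
      apply mul_left_cancel₀ m
      have m2 : (q : ℂ) ^ n ≠ 0 := pow_ne_zero _ hq
      have e3 : (q : ℂ) / q ^ (n + 1) = ((q : ℂ) ^ n)⁻¹ := by
        rw [pow_succ]; field_simp
      rw [e3, h.pochQ_eq n] at l
      linear_combination l - qPochInf ((q : ℂ) ^ (n + 2)) (q : ℂ) * l2

end Eigenfunctions

/-! ### The weight, the Casorati determinant, and the orthogonality relations -/

section Weight

variable {q c d : ℝ}

/-- The mass of the point `q^{-k}/c`. -/
def mass (q c d : ℝ) (k : ℕ) : ℝ := (1 - q) * weightW q c d k * pt q c k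

lemma ofReal_qPochInf (hq0 : 0 < q) (hq1 : q < 1) (a : ℝ) :
    ((qPochInf a q : ℝ) : ℂ) = qPochInf (a : ℂ) (q : ℂ) := by
  have hs : Summable fun i : ℕ => ‖-(a * q ^ i)‖ := by
    simp only [norm_neg, norm_mul, norm_pow]
    exact (summable_geometric_of_lt_one (norm_nonneg q)
      (by rwa [Real.norm_of_nonneg hq0.le])).mul_left _
  have hm : Multipliable fun i : ℕ => 1 - a * q ^ i := by
    simpa [sub_eq_add_neg] using multipliable_one_add_of_summable hs
  have := hm.map_tprod Complex.ofRealHom Complex.continuous_ofReal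
  simpa [qPochInf] using this

lemma ofReal_qPoch (a : ℝ) (n : ℕ) : ((qPoch a q n : ℝ) : ℂ) = qPoch (a : ℂ) (q : ℂ) n := by
  simp [qPoch]

lemma real_qPochInf_eq_mul (hq0 : 0 < q) (hq1 : q < 1) (a : ℝ) :
    qPochInf a q = (1 - a) * qPochInf (q * a) q := by
  have hq : ‖(q : ℂ)‖ < 1 := by simpa [abs_of_pos hq0] using hq1
  have := qPochInf_eq_mul hq (a : ℂ)
  rw [← Complex.ofReal_inj]
  push_cast
  rw [ofReal_qPochInf hq0 hq1, ofReal_qPochInf hq0 hq1, this]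
  push_cast
  rfl

lemma real_qPochInf_pos (hq0 : 0 < q) (hq1 : q < 1) {a : ℝ} (ha0 : 0 ≤ a) (ha1 : a < 1) :
    0 < qPochInf a q := by
  have hq : ‖(q : ℂ)‖ < 1 := by simpa [abs_of_pos hq0] using hq1
  have hne : qPochInf a q ≠ 0 := by
    have := qPochInf_ne_zero hq (a := (a : ℂ)) (by simpa [abs_of_nonneg ha0] using ha1)
    rw [← ofReal_qPochInf hq0 hq1] at this
    exact_mod_cast this
  refine lt_of_le_of_ne ?_ hne.symm
  have ht : Tendsto (fun n => qPoch a q n) atTop (𝓝 (qPochInf a q)) := by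
    have := tendsto_qPoch hq (a : ℂ)
    rw [← ofReal_qPochInf hq0 hq1] at this
    simpa only [← ofReal_qPoch, Complex.ofReal_re, Function.comp_def] using
      (Complex.continuous_re.tendsto _).comp this
  refine ge_of_tendsto' ht fun n => Finset.prod_nonneg fun i _ => ?_
  have : a * q ^ i ≤ 1 := (mul_le_of_le_one_right ha0 (pow_le_one₀ hq0.le hq1.le)).trans ha1.le
  linarith

lemma Admissible.pow_succ_lt (h : Admissible q c d) (k : ℕ) : q ^ (k + 1) < 1 :=
  pow_lt_one₀ h.q_pos.le h.q_lt (by simp)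

lemma mass_pos (h : Admissible q c d) (k : ℕ) : 0 < mass q c d k := by
  have h0 := h.q_pos
  have h1 := sub_pos.2 h.q_lt
  have h2 := h.c_pos
  have h3 := h.d_pos
  have h4 := real_qPochInf_pos h0 h.q_lt (h.mul_pow_pos k).le (h.mul_pow_lt k)
  have h5 := real_qPochInf_pos h0 h.q_lt (by positivity) (h.pow_succ_lt k)
  unfold mass weightW pt
  positivity

/-- This is the detailed balance equation `m(k+1) A(x_{k+1}) = m(k) B(x_k)`, the symmetry of `L` in
`H`. It underlies the constancy of the Casorati determinant, the summation by parts and the row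
norms. -/
lemma mass_succ (h : Admissible q c d) (k : ℕ) :
    mass q c d (k + 1) * ((1 - q ^ (k + 1)) * (1 - c / d * q ^ (k + 1)))
      = mass q c d k * (c / d * q ^ (2 * k + 1)) := by
  have hq := h.q_pos.ne'
  have hc := h.c_pos.ne'
  have hd := h.d_pos.ne'
  have e1 := real_qPochInf_eq_mul h.q_pos h.q_lt (c * q ^ (k + 1) / d)
  have e2 := real_qPochInf_eq_mul h.q_pos h.q_lt (q ^ (k + 1))
  rw [show q * (c * q ^ (k + 1) / d) = c * q ^ (k + 1 + 1) / d by ring] at e1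
  rw [← pow_succ'] at e2
  simp only [mass, weightW, pt]
  rw [e1, e2, show c * q ^ (k + 1) / d = c / d * q ^ (k + 1) by ring]
  generalize qPochInf (c * q ^ (k + 1 + 1) / d) q = Q1
  generalize qPochInf (q ^ (k + 1 + 1)) q = Q2
  generalize c / d = a
  field_simp
  ring

lemma mass_zero (h : Admissible q c d) :
    mass q c d 0 = (1 - q) / c * qPochInf (c * q / d) q * qPochInf q q := by
  have hc := h.c_pos.ne'
  simp [mass, weightW, pt]
  field_simp

lemma casorati_eq (h : Admissible q c d) (f g : ℕ → ℂ) (j : ℕ) :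
    casorati q c d f g j = (f (j + 1) * g j - f j * g (j + 1)) *
      ((mass q c d j * (c / d * q ^ (2 * j + 1)) : ℝ) : ℂ) := by
  rw [casorati, ← mass_succ h, mass, coeffA_pt h]
  congr 2
  ring

/-- As for a Wronskian, the eigenvalue terms cancel in `g·Lf - f·Lg`, and the detailed balance
equation makes the remaining differences telescope. -/
lemma casorati_succ (h : Admissible q c d) {f g : ℕ → ℂ} {l : ℂ} {j : ℕ}
    (hf : opL q c d f (j + 1) = l * f (j + 1)) (hg : opL q c d g (j + 1) = l * g (j + 1)) :
    casorati q c d f g (j + 1) = casorati q c d f g j := by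
  rw [casorati_eq h, casorati_eq h, ← mass_succ h j]
  rw [opL_succ h] at hf hg
  push_cast
  linear_combination (mass q c d (j + 1) : ℂ) * (g (j + 1) * hf - f (j + 1) * hg)

lemma casorati_eq_detD (h : Admissible q c d) {γ : ℂ} (hγ : γ ≠ 0) (j : ℕ) :
    casorati q c d (eigPhi q c d γ) (eigPsi q c d γ) j = detD q c d γ := by
  induction j with
  | zero => rfl
  | succ j ih => rw [casorati_succ h (eigPhi_opL_succ h hγ j) (eigPsi_opL_succ h γ j), ih]

/-- The determinant is evaluated between the indices `0` and `1`, where the boundary equations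
express both first differences. Everything cancels except the defect of `φ_γ` multiplied by
`Ψ_γ(1/c) = (qγ;q)_∞`. -/
lemma detD_eq (h : Admissible q c d) {γ : ℂ} (hγ : γ ≠ 0) :
    detD q c d γ = (1 - q) / c * qPochInf (q * γ) (q : ℂ) * qPochInf γ (q : ℂ)
      * qPochInf (q / γ) (q : ℂ) := by
  have hc := h.c_ne
  have n1 := h.pochC_ne 0
  have n2 := h.pochQ_ne 0
  rw [zero_add, pow_one] at n1 n2
  have e1 := eigPhi_opL_zero h hγ
  have e2 := eigPsi_opL_zero h γ
  rw [opL_zero h] at e1 e2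
  rw [detD, casorati_eq h, mass_zero h]
  rw [eigPsi_zero h] at e2 ⊢
  push_cast
  rw [ofReal_qPochInf h.q_pos h.q_lt, ofReal_qPochInf h.q_pos h.q_lt]
  push_cast
  have e3 : (qPochInf γ (q : ℂ) * qPochInf (q / γ) (q : ℂ)
        / (qPochInf (q : ℂ) (q : ℂ) * qPochInf ((c : ℂ) * q / d) (q : ℂ)))
      * (qPochInf (q : ℂ) (q : ℂ) * qPochInf ((c : ℂ) * q / d) (q : ℂ))
      = qPochInf γ (q : ℂ) * qPochInf (q / γ) (q : ℂ) :=
    div_mul_cancel₀ _ (mul_ne_zero n2 n1)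
  linear_combination (1 - (q : ℂ)) / c * qPochInf ((c : ℂ) * q / d) (q : ℂ) * qPochInf (q : ℂ) (q : ℂ)
    * (qPochInf (q * γ) (q : ℂ) * e1 - eigPhi q c d γ 0 * e2)
    + (1 - (q : ℂ)) / c * qPochInf (q * γ) (q : ℂ) * e3

/-- Sequences of at most exponential growth. -/
def ExpBdd (f : ℕ → ℝ) : Prop := ∃ C R : ℝ, ∀ k, |f k| ≤ C * R ^ k

lemma ExpBdd.const (x : ℝ) : ExpBdd fun _ => x := ⟨|x|, 1, by simp⟩

lemma ExpBdd.pow (x : ℝ) : ExpBdd fun k => x ^ k := ⟨1, |x|, by simp [abs_pow]⟩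

lemma ExpBdd.mul {f g : ℕ → ℝ} (hf : ExpBdd f) (hg : ExpBdd g) : ExpBdd fun k => f k * g k := by
  obtain ⟨C, R, h⟩ := hf
  obtain ⟨C', R', h'⟩ := hg
  refine ⟨C * C', R * R', fun k => ?_⟩
  rw [abs_mul, mul_pow]
  calc |f k| * |g k| ≤ (C * R ^ k) * (C' * R' ^ k) :=
        mul_le_mul (h k) (h' k) (abs_nonneg _) ((abs_nonneg _).trans (h k))
    _ = _ := by ring

lemma ExpBdd.add {f g : ℕ → ℝ} (hf : ExpBdd f) (hg : ExpBdd g) : ExpBdd fun k => f k + g k := by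
  obtain ⟨C, R, h⟩ := hf
  obtain ⟨C', R', h'⟩ := hg
  refine ⟨|C| + |C'|, |R| + |R'|, fun k => ?_⟩
  have h1 : |f k| ≤ |C| * (|R| + |R'|) ^ k := by
    refine ((h k).trans (le_abs_self _)).trans ?_
    rw [abs_mul, abs_pow]
    gcongr
    exact le_add_of_nonneg_right (abs_nonneg _)
  have h2 : |g k| ≤ |C'| * (|R| + |R'|) ^ k := by
    refine ((h' k).trans (le_abs_self _)).trans ?_
    rw [abs_mul, abs_pow]
    gcongr
    exact le_add_of_nonneg_left (abs_nonneg _)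
  rw [add_mul]
  exact (abs_add_le _ _).trans (add_le_add h1 h2)

lemma ExpBdd.sum {ι : Type*} {s : Finset ι} {f : ι → ℕ → ℝ} (hf : ∀ i ∈ s, ExpBdd (f i)) :
    ExpBdd fun k => ∑ i ∈ s, f i k := by
  classical
  induction s using Finset.induction_on with
  | empty => simpa using ExpBdd.const 0
  | insert i s hi ih =>
    simp only [Finset.sum_insert hi]
    exact (hf i (by simp)).add (ih fun j hj => hf j (by simp [hj]))

lemma ExpBdd.prod {ι : Type*} {s : Finset ι} {f : ι → ℕ → ℝ} (hf : ∀ i ∈ s, ExpBdd (f i)) :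
    ExpBdd fun k => ∏ i ∈ s, f i k := by
  classical
  induction s using Finset.induction_on with
  | empty => simpa using ExpBdd.const 1
  | insert i s hi ih =>
    simp only [Finset.prod_insert hi]
    exact (hf i (by simp)).mul (ih fun j hj => hf j (by simp [hj]))

lemma ExpBdd.comp_succ {f : ℕ → ℝ} (hf : ExpBdd f) : ExpBdd fun k => f (k + 1) := by
  obtain ⟨C, R, h⟩ := hf
  exact ⟨C * R, R, fun k => (h (k + 1)).trans_eq (by ring)⟩

lemma expBdd_seqV (h : Admissible q c d) (n : ℕ) : ExpBdd (seqV q c d n) := by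
  have hz : ExpBdd fun k => c * pt q c k := by
    have := h.c_pos.ne'
    refine (ExpBdd.pow q⁻¹).mul (ExpBdd.const 1) |> fun e => ?_
    convert e using 2 with k
    simp only [pt, inv_pow]
    field_simp
  unfold seqV polyV phi20 qPoch
  refine (ExpBdd.const _).mul (ExpBdd.sum fun j _ => ?_)
  simp only [div_eq_mul_inv]
  refine ((((ExpBdd.const _).mul (ExpBdd.prod fun i _ => ?_)).mul (ExpBdd.const _)).mul
    (ExpBdd.const _)).mul (ExpBdd.const _)
  have := (ExpBdd.const 1).add ((hz.mul (ExpBdd.const (q ^ i))).mul (ExpBdd.const (-1)))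
  convert this using 2
  ring

/-! ### Decay of the mass and summability -/

lemma mass_succ_div (h : Admissible q c d) (k : ℕ) :
    mass q c d (k + 1) / mass q c d k
      = c / d * q ^ (2 * k + 1) / ((1 - q ^ (k + 1)) * (1 - c / d * q ^ (k + 1))) := by
  have h1 := (mass_pos h k).ne'
  have h2 : 1 - q ^ (k + 1) ≠ 0 := (sub_pos.2 (h.pow_succ_lt k)).ne'
  have h3 : 1 - c / d * q ^ (k + 1) ≠ 0 := by
    have := h.mul_pow_lt k
    rw [show c * q ^ (k + 1) / d = c / d * q ^ (k + 1) by ring] at this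
    exact (sub_pos.2 this).ne'
  rw [div_eq_div_iff h1 (mul_ne_zero h2 h3), mass_succ h]
  ring

lemma tendsto_one_sub_mul_pow (h : Admissible q c d) (x : ℝ) :
    Tendsto (fun k : ℕ => 1 - x * q ^ (k + 1)) atTop (𝓝 1) := by
  have := ((tendsto_add_atTop_iff_nat 1).2
    (tendsto_pow_atTop_nhds_zero_of_lt_one h.q_pos.le h.q_lt)).const_mul x
  simpa using this.const_sub 1

/-- The ratio of consecutive masses is of order `q^{2k}`, so the mass beats any exponential, in
particular any polynomial in `q^{-k}`. -/
lemma summable_mass_mul_pow (h : Admissible q c d) (r : ℝ) :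
    Summable fun k => mass q c d k * r ^ k := by
  rcases eq_or_ne r 0 with rfl | hr
  · exact summable_of_ne_finset_zero (s := Finset.range 1) fun n hn => by
      have : n ≠ 0 := by simpa using hn
      simp [this]
  refine summable_of_ratio_test_tendsto_lt_one (l := 0) zero_lt_one
    (Eventually.of_forall fun n => mul_ne_zero (mass_pos h n).ne' (pow_ne_zero _ hr)) ?_
  have h1 : Tendsto (fun k : ℕ => c / d * q * |r| * (q ^ 2) ^ k
      / ((1 - 1 * q ^ (k + 1)) * (1 - c / d * q ^ (k + 1)))) atTop
      (𝓝 (c / d * q * |r| * 0 / (1 * 1))) := by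
    refine Tendsto.div (Tendsto.const_mul _ ?_)
      ((tendsto_one_sub_mul_pow h 1).mul (tendsto_one_sub_mul_pow h _)) (by simp)
    exact tendsto_pow_atTop_nhds_zero_of_lt_one (by positivity)
      (pow_lt_one₀ h.q_pos.le h.q_lt (by simp))
  rw [mul_zero, zero_div] at h1
  refine h1.congr fun k => ?_
  have h2 := mass_pos h k
  have h3 := mass_pos h (k + 1)
  rw [norm_mul, norm_mul, norm_pow, norm_pow, Real.norm_of_nonneg h2.le,
    Real.norm_of_nonneg h3.le, mul_div_mul_comm (mass q c d (k + 1)), mass_succ_div h, one_mul,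
    Real.norm_eq_abs, pow_succ |r|, mul_div_cancel_left₀ _ (pow_ne_zero _ (abs_ne_zero.2 hr))]
  ring

lemma ExpBdd.summable (h : Admissible q c d) {f : ℕ → ℝ} (hf : ExpBdd f) :
    Summable fun k => mass q c d k * f k := by
  obtain ⟨C, R, hb⟩ := hf
  refine ((summable_mass_mul_pow h R).mul_left C).of_norm_bounded fun k => ?_
  rw [norm_mul, Real.norm_of_nonneg (mass_pos h k).le, Real.norm_eq_abs]
  calc mass q c d k * |f k| ≤ mass q c d k * (C * R ^ k) := by
        have := (mass_pos h k).le
        gcongr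
        exact hb k
    _ = _ := by ring

/-! ### Eigenvalue equation, orthogonality and relative norms -/

lemma seqV_opL (h : Admissible q c d) (n k : ℕ) :
    opL q c d (fun j => (seqV q c d n j : ℂ)) k = (q ^ n - 1) * (seqV q c d n k : ℂ) := by
  have hγ : (q : ℂ) ^ n ≠ 0 := pow_ne_zero _ h.q_ne
  have hP := h.pochQ_ne n
  have hf : eigPhi q c d ((q : ℂ) ^ n)
      = fun j => qPochInf ((q : ℂ) ^ (n + 1)) (q : ℂ) * (seqV q c d n j : ℂ) :=
    funext fun j => eigPhi_pow h n j
  apply mul_left_cancel₀ hP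
  cases k with
  | zero =>
    have e := eigPhi_opL_zero h hγ
    have hz : qPochInf ((q : ℂ) ^ n) (q : ℂ) * qPochInf ((q : ℂ) / q ^ n) (q : ℂ) = 0 := by
      cases n with
      | zero => rw [pow_zero, qPochInf_eq_mul h.norm_lt 1]; simp
      | succ n =>
        rw [qPochInf_eq_qPoch_mul h.norm_lt (_ / _) (n + 1), qPoch_succ]
        have hq := h.q_ne
        have : (q : ℂ) / q ^ (n + 1) * q ^ n = 1 := by rw [pow_succ]; field_simp
        rw [this]; simp
    rw [hz, zero_div, add_zero, hf, opL_zero h] at e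
    rw [opL_zero h]
    linear_combination e
  | succ k =>
    have e := eigPhi_opL_succ h hγ k
    rw [hf, opL_succ h] at e
    rw [opL_succ h]
    linear_combination e

lemma seqV_raising (h : Admissible q c d) (n k : ℕ) :
    (1 - q ^ (k + 1)) * (1 - c / d * q ^ (k + 1)) * seqV q c d n k
      - c / d * (q ^ (k + 1)) ^ 2 * seqV q c d n (k + 1)
      = q ^ n * q ^ (k + 1) * seqV q c d (n + 1) (k + 1) := by
  have hγ : (q : ℂ) ^ n ≠ 0 := pow_ne_zero _ h.q_ne
  have e := eigPhi_raising h hγ k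
  rw [← pow_succ', eigPhi_pow h, eigPhi_pow h, eigPhi_pow h] at e
  have hP := h.pochQ_ne n
  rw [← Complex.ofReal_inj]
  apply mul_left_cancel₀ hP
  have p := h.pochQ_eq n
  push_cast
  linear_combination e - (q ^ n * q ^ (k + 1) * (seqV q c d (n + 1) (k + 1) : ℂ)) * p

lemma seqV_raising_zero (h : Admissible q c d) (n : ℕ) :
    -(c / d) * seqV q c d n 0 = q ^ n * seqV q c d (n + 1) 0 := by
  have hq := h.q_pos.ne'
  rw [seqV_at_zero h, seqV_at_zero h, Nat.choose_succ_succ' n 1, Nat.choose_one_right]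
  field_simp
  ring

/-- The inner products of the polynomials. -/
def innerV (q c d : ℝ) (m n : ℕ) : ℝ := ∑' k, mass q c d k * (seqV q c d m k * seqV q c d n k)

/-- Raising `V_n` is adjoint, up to a constant, to the difference operator on `g`: the detailed
balance equation moves the shift from the weight to `g`. -/
lemma seqV_summation_by_parts (h : Admissible q c d) (n : ℕ) {g : ℕ → ℝ} (hg : ExpBdd g) :
    q ^ n * ∑' k, mass q c d k * (seqV q c d (n + 1) k * g k)
      = c / d / q * ∑' k, mass q c d k * (seqV q c d n k * (q ^ (k + 1) * (g (k + 1) - g k))) := by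
  have hq := h.q_pos.ne'
  have hV := expBdd_seqV h n
  have s1 := ((expBdd_seqV h (n + 1)).mul hg).summable h
  have s2 : Summable fun k => mass q c d k * (c / d * q ^ k * seqV q c d n k * g k) := by
    refine ExpBdd.summable h ?_
    exact (((ExpBdd.const _).mul (ExpBdd.pow q)).mul hV).mul hg
  have s3 : Summable fun k => mass q c d k * (c / d * q ^ k * seqV q c d n k * g (k + 1)) := by
    refine ExpBdd.summable h ?_
    exact (((ExpBdd.const _).mul (ExpBdd.pow q)).mul hV).mul hg.comp_succ
  -- The boundary form of the raising relation makes the `k = 0` term vanish, so no boundary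
  -- contribution remains after the shift of index.
  have e0 : q ^ n * (mass q c d 0 * (seqV q c d (n + 1) 0 * g 0))
      + mass q c d 0 * (c / d * q ^ 0 * seqV q c d n 0 * g 0) = 0 := by
    linear_combination (-mass q c d 0 * g 0) * seqV_raising_zero h n
  have e1 : ∀ k, q ^ n * (mass q c d (k + 1) * (seqV q c d (n + 1) (k + 1) * g (k + 1)))
      + mass q c d (k + 1) * (c / d * q ^ (k + 1) * seqV q c d n (k + 1) * g (k + 1))
      = mass q c d k * (c / d * q ^ k * seqV q c d n k * g (k + 1)) := fun k => by
    have hk : q ^ (k + 1) ≠ 0 := pow_ne_zero _ hq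
    apply mul_left_cancel₀ hk
    linear_combination (-mass q c d (k + 1) * g (k + 1)) * seqV_raising h n k
      + (seqV q c d n k * g (k + 1)) * mass_succ h k
  have t1 : ∑' k, (q ^ n * (mass q c d k * (seqV q c d (n + 1) k * g k))
      + mass q c d k * (c / d * q ^ k * seqV q c d n k * g k))
      = ∑' k, mass q c d k * (c / d * q ^ k * seqV q c d n k * g (k + 1)) := by
    rw [((s1.mul_left (q ^ n)).add s2).tsum_eq_zero_add, e0, zero_add]
    exact tsum_congr e1
  rw [(s1.mul_left (q ^ n)).tsum_add s2, tsum_mul_left, ← eq_sub_iff_add_eq, ← s3.tsum_sub s2] at t1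
  rw [t1, ← tsum_mul_left]
  refine tsum_congr fun k => ?_
  field_simp
  ring

/-- Take `g = V_{n+1}` in the summation by parts; the lowering relation turns its difference into a
multiple of `V_n`. -/
lemma innerV_succ_succ (h : Admissible q c d) (m n : ℕ) :
    q ^ (m + n + 1) * innerV q c d (m + 1) (n + 1)
      = c / d * (1 - q ^ (n + 1)) * innerV q c d m n := by
  have hq := h.q_pos.ne'
  have e := seqV_summation_by_parts h m (expBdd_seqV h (n + 1))
  simp only [seqV_lowering h] at e
  have e2 : ∑' k, mass q c d k * (seqV q c d m k * ((q ^ n)⁻¹ * (1 - q ^ (n + 1)) * seqV q c d n k))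
      = (q ^ n)⁻¹ * (1 - q ^ (n + 1)) * innerV q c d m n := by
    rw [innerV, ← tsum_mul_left]
    exact tsum_congr fun k => by ring
  rw [e2] at e
  change q ^ m * innerV q c d (m + 1) (n + 1) = _ at e
  rw [show m + n + 1 = m + (n + 1) by ring, pow_add, mul_right_comm, e, pow_succ]
  field_simp

lemma innerV_succ_zero (h : Admissible q c d) (m : ℕ) : innerV q c d (m + 1) 0 = 0 := by
  have e := seqV_summation_by_parts h m (expBdd_seqV h 0)
  simp only [seqV_zero, sub_self, mul_zero, tsum_zero] at e
  simpa [h.q_pos.ne', innerV, seqV_zero] using e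

lemma innerV_comm (m n : ℕ) : innerV q c d m n = innerV q c d n m :=
  tsum_congr fun k => by ring

lemma innerV_of_ne (h : Admissible q c d) {m n : ℕ} (hmn : m ≠ n) : innerV q c d m n = 0 := by
  induction m generalizing n with
  | zero =>
    obtain ⟨n, rfl⟩ := Nat.exists_eq_succ_of_ne_zero hmn.symm
    rw [innerV_comm]; exact innerV_succ_zero h n
  | succ m ih =>
    cases n with
    | zero => exact innerV_succ_zero h m
    | succ n =>
      have e := innerV_succ_succ h m n
      rw [ih (by omega), mul_zero] at e
      exact (mul_eq_zero.1 e).resolve_left (pow_ne_zero _ h.q_pos.ne')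

lemma innerV_self (h : Admissible q c d) (n : ℕ) :
    innerV q c d n n = (c / d) ^ n * (q ^ n ^ 2)⁻¹ * qPoch q q n * innerV q c d 0 0 := by
  have hq := h.q_pos.ne'
  induction n with
  | zero => simp
  | succ n ih =>
    have e := innerV_succ_succ h n n
    apply mul_left_cancel₀ (pow_ne_zero (n + n + 1) hq)
    rw [e, ih, qPoch_succ, show (n + 1) ^ 2 = n ^ 2 + (n + n + 1) by ring, pow_add q]
    field_simp
    ring

lemma innerV_zero_pos (h : Admissible q c d) : 0 < innerV q c d 0 0 := by
  have s := ((ExpBdd.const 1).summable h)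
  simp only [innerV, seqV_zero, mul_one] at s ⊢
  exact s.tsum_pos (fun k => (mass_pos h k).le) 0 (mass_pos h 0)

lemma real_qPoch_pos (hq0 : 0 < q) (hq1 : q < 1) (n : ℕ) : 0 < qPoch q q n :=
  Finset.prod_pos fun i _ => by
    rw [← pow_succ']; exact sub_pos.2 (pow_lt_one₀ hq0.le hq1 (by simp))

lemma innerV_self_pos (h : Admissible q c d) (n : ℕ) : 0 < innerV q c d n n := by
  rw [innerV_self h]
  have h1 := h.q_pos
  have h2 := h.c_pos
  have h3 := h.d_pos
  have h4 := innerV_zero_pos h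
  have h5 := real_qPoch_pos h.q_pos h.q_lt n
  positivity

end Weight

/-! ### The Hilbert space in coordinates -/

section Coordinates

variable {q c d : ℝ}

lemma jacksonMeasure_eq (q c d : ℝ) : jacksonMeasure q c d
    = Measure.sum fun k : ℕ => ENNReal.ofReal (mass q c d k) • Measure.dirac k := rfl

lemma jacksonMeasure_singleton (h : Admissible q c d) (k : ℕ) :
    jacksonMeasure q c d {k} ≠ 0 := by
  rw [jacksonMeasure_eq, Measure.sum_smul_dirac_singleton]
  simpa using mass_pos h k

/-- Every point has positive mass, so elements of `H` have well-defined values and can be handled as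
sequences. -/
lemma eq_of_ae_eq (h : Admissible q c d) {f g : ℕ → ℂ} (hfg : f =ᵐ[jacksonMeasure q c d] g)
    (k : ℕ) : f k = g k :=
  ae_iff_of_countable.1 hfg k (jacksonMeasure_singleton h k)

lemma HilbertH.add_apply (h : Admissible q c d) (f g : HilbertH q c d) (k : ℕ) :
    (f + g) k = f k + g k := eq_of_ae_eq h (Lp.coeFn_add f g) k

lemma HilbertH.smul_apply (h : Admissible q c d) (x : ℂ) (f : HilbertH q c d) (k : ℕ) :
    (x • f) k = x * f k := eq_of_ae_eq h (Lp.coeFn_smul x f) k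

lemma HilbertH.ext {f g : HilbertH q c d} (hfg : ∀ k, f k = g k) :
    f = g := Lp.ext (Eventually.of_forall hfg)

lemma integrable_iff_summable (h : Admissible q c d) {f : ℕ → ℂ} :
    Integrable f (jacksonMeasure q c d) ↔ Summable fun k => mass q c d k * ‖f k‖ := by
  rw [jacksonMeasure_eq, integrable_sum_dirac_iff fun _ => ENNReal.ofReal_ne_top]
  simp [ENNReal.toReal_ofReal (mass_pos h _).le]

lemma hasSum_inner (h : Admissible q c d) (f g : HilbertH q c d) :
    HasSum (fun k => (mass q c d k : ℂ) * (starRingEnd ℂ (f k) * g k)) (inner ℂ f g) := by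
  have hi := L2.integrable_inner (𝕜 := ℂ) f g
  have hs := (integrable_iff_summable h).1 hi
  have := hasSum_integral_sum_dirac (X := ℕ) (x := id) (c := fun k => ENNReal.ofReal (mass q c d k))
    (fun _ => ENNReal.ofReal_ne_top)
    (f := fun a => inner ℂ (f a) (g a)) (by simpa [ENNReal.toReal_ofReal (mass_pos h _).le] using hs)
  rw [L2.inner_def]
  refine this.congr_fun fun k => ?_
  simp [ENNReal.toReal_ofReal (mass_pos h _).le, mul_comm]

lemma hasSum_norm_sq (h : Admissible q c d) (f : HilbertH q c d) :
    HasSum (fun k => mass q c d k * ‖f k‖ ^ 2) (‖f‖ ^ 2) := by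
  have := hasSum_inner h f f
  rw [inner_self_eq_norm_sq_to_K] at this
  refine Complex.hasSum_ofReal.1 ?_
  push_cast
  refine this.congr_fun fun k => ?_
  rw [Complex.conj_mul']

/-- The element of `H` with given values. -/
lemma exists_coord (h : Admissible q c d) {f : ℕ → ℂ}
    (hf : Summable fun k => mass q c d k * ‖f k‖ ^ 2) : ∃ F : HilbertH q c d, ∀ k, F k = f k := by
  have hm : MemLp f 2 (jacksonMeasure q c d) := by
    rw [memLp_two_iff_integrable_sq_norm (by fun_prop)]
    have := (integrable_iff_summable h (f := fun k => ((‖f k‖ ^ 2 : ℝ) : ℂ))).2 (by simpa using hf)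
    refine this.re.congr (Eventually.of_forall fun k => ?_)
    exact Complex.ofReal_re _
  exact ⟨hm.toLp f, fun k => eq_of_ae_eq h hm.coeFn_toLp k⟩

lemma exists_evalVec (h : Admissible q c d) (k : ℕ) :
    ∃ F : HilbertH q c d, ∀ j, F j = if j = k then ((mass q c d k)⁻¹ : ℂ) else 0 :=
  exists_coord h (summable_of_ne_finset_zero (s := {k}) fun j hj => by
    have : j ≠ k := by simpa using hj
    simp [this])

/-- The vector representing evaluation at the `k`-th point. -/
def evalVec (h : Admissible q c d) (k : ℕ) : HilbertH q c d := (exists_evalVec h k).choose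

lemma evalVec_apply (h : Admissible q c d) (k j : ℕ) :
    evalVec h k j = if j = k then ((mass q c d k)⁻¹ : ℂ) else 0 := (exists_evalVec h k).choose_spec j

lemma inner_evalVec (h : Admissible q c d) (k : ℕ) (f : HilbertH q c d) :
    inner ℂ (evalVec h k) f = f k := by
  have hm : (mass q c d k : ℂ) ≠ 0 := by exact_mod_cast (mass_pos h k).ne'
  refine (hasSum_inner h (evalVec h k) f).unique ?_
  convert hasSum_single k fun j hj => ?_ using 1
  · simp [evalVec_apply, hm]
  · simp [evalVec_apply, hj]

lemma exists_vecV (h : Admissible q c d) (n : ℕ) :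
    ∃ F : HilbertH q c d, ∀ k, F k = (seqV q c d n k : ℂ) :=
  exists_coord h (by
    have := (((expBdd_seqV h n).mul (expBdd_seqV h n)).summable h)
    refine this.congr fun k => ?_
    rw [Complex.norm_real, Real.norm_eq_abs, sq_abs, sq])

/-- The Al-Salam--Carlitz polynomials as elements of `H`. -/
def vecV (h : Admissible q c d) (n : ℕ) : HilbertH q c d := (exists_vecV h n).choose

lemma vecV_apply (h : Admissible q c d) (n k : ℕ) : vecV h n k = (seqV q c d n k : ℂ) :=
  (exists_vecV h n).choose_spec k

lemma inner_vecV (h : Admissible q c d) (m n : ℕ) :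
    inner ℂ (vecV h m) (vecV h n) = (innerV q c d m n : ℂ) := by
  rw [← (hasSum_inner h (vecV h m) (vecV h n)).tsum_eq, innerV, Complex.ofReal_tsum]
  refine tsum_congr fun k => ?_
  simp [vecV_apply]

lemma norm_vecV_sq (h : Admissible q c d) (n : ℕ) : ‖vecV h n‖ ^ 2 = innerV q c d n n := by
  have := inner_vecV h n n
  rw [inner_self_eq_norm_sq_to_K] at this
  change (‖vecV h n‖ : ℂ) ^ 2 = _ at this
  exact_mod_cast this

lemma vecV_ne_zero (h : Admissible q c d) (n : ℕ) : vecV h n ≠ 0 := by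
  intro h0
  have := norm_vecV_sq h n
  rw [h0] at this
  have h2 := innerV_self_pos h n
  simp at this
  linarith

/-- The normalized Al-Salam--Carlitz polynomials. -/
def unitV (h : Admissible q c d) (n : ℕ) : HilbertH q c d := (‖vecV h n‖ : ℂ)⁻¹ • vecV h n

lemma orthonormal_unitV (h : Admissible q c d) : Orthonormal ℂ (unitV h) := by
  constructor
  · intro n
    have := norm_ne_zero_iff.2 (vecV_ne_zero h n)
    simp [unitV, norm_smul, this]
  · intro m n hmn
    simp [unitV, inner_smul_left, inner_smul_right, inner_vecV, innerV_of_ne h hmn]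

lemma vecV_eq_smul (h : Admissible q c d) (n : ℕ) : vecV h n = (‖vecV h n‖ : ℂ) • unitV h n := by
  have : (‖vecV h n‖ : ℂ) ≠ 0 := by exact_mod_cast norm_ne_zero_iff.2 (vecV_ne_zero h n)
  rw [unitV, smul_smul, mul_inv_cancel₀ this, one_smul]

/-- The vector representing the functional `f ↦ (Lf + f)(q^{-k}/c)`. -/
def rowVec (h : Admissible q c d) : ℕ → HilbertH q c d
  | 0 => (1 - c / d * q : ℂ) • evalVec h 0 + (c / d * q : ℂ) • evalVec h 1
  | k + 1 => ((1 - (q : ℂ) ^ (k + 1)) * (1 - c / d * q ^ (k + 1))) • evalVec h k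
      + ((1 + c / d) * q ^ (k + 1) - c / d * (1 + q) * (q ^ (k + 1)) ^ 2 : ℂ) • evalVec h (k + 1)
      + (c / d * q ^ (2 * k + 3) : ℂ) • evalVec h (k + 2)

lemma inner_rowVec (h : Admissible q c d) (k : ℕ) (f : HilbertH q c d) :
    inner ℂ (rowVec h k) f = opL q c d f k + f k := by
  cases k with
  | zero =>
    simp only [rowVec, inner_add_left, inner_smul_left, inner_evalVec, opL_zero h]
    simp
    ring
  | succ k =>
    simp only [rowVec, inner_add_left, inner_smul_left, inner_evalVec, opL_succ h]
    simp
    ring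

/-- The Hilbert--Schmidt weight of the `k`-th row of `L + 1`, as a polynomial in `y = q^k`. -/
def rowWeight (q a y : ℝ) : ℝ :=
  (1 - y) * (1 - a * y) * (a * y ^ 2 / q) + ((1 + a) * y - a * (1 + q) * y ^ 2) ^ 2
    + a * q * y ^ 2 * ((1 - q * y) * (1 - a * q * y))

/-- The squared norm is the row functional applied to its own vector. Detailed balance removes the
ratios of masses: the off-diagonal entries contribute `A(x_k) B(x_{k-1})` and `B(x_k) A(x_{k+1})`.
The first of these vanishes at `k = 0`, so the boundary row fits the same formula. -/
lemma mass_mul_norm_rowVec_sq (h : Admissible q c d) (k : ℕ) :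
    mass q c d k * ‖rowVec h k‖ ^ 2 = rowWeight q (c / d) (q ^ k) := by
  have e := inner_rowVec h k (rowVec h k)
  rw [inner_self_eq_norm_sq_to_K] at e
  rw [← Complex.ofReal_inj]
  push_cast
  change (‖rowVec h k‖ : ℂ) ^ 2 = _ at e
  rw [e]
  have hq := h.q_ne
  cases k with
  | zero =>
    have m0 : (mass q c d 0 : ℂ) ≠ 0 := by exact_mod_cast (mass_pos h 0).ne'
    have m1 : (mass q c d 1 : ℂ) ≠ 0 := by exact_mod_cast (mass_pos h 1).ne'
    have r := congrArg (fun x : ℝ => (x : ℂ)) (mass_succ h 0)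
    push_cast at r
    simp only [pow_one] at r
    have r' : (mass q c d 0 : ℂ) * (c / d * q) * (mass q c d 1 : ℂ)⁻¹
        = (1 - (q : ℂ)) * (1 - c / d * q) := by
      rw [← r]; field_simp
    simp only [opL_zero h, rowVec, HilbertH.add_apply h, HilbertH.smul_apply h, evalVec_apply]
    simp [rowWeight]
    generalize (c : ℂ) / d = a at *
    have r2 : (mass q c d 0 : ℂ) * (mass q c d 0 : ℂ)⁻¹ = 1 := mul_inv_cancel₀ m0
    linear_combination a * q * r' + (1 - a * q) ^ 2 * r2
  | succ k =>
    have m0 : (mass q c d k : ℂ) ≠ 0 := by exact_mod_cast (mass_pos h k).ne'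
    have m1 : (mass q c d (k + 1) : ℂ) ≠ 0 := by exact_mod_cast (mass_pos h (k + 1)).ne'
    have m2 : (mass q c d (k + 2) : ℂ) ≠ 0 := by exact_mod_cast (mass_pos h (k + 2)).ne'
    have r := congrArg (fun x : ℝ => (x : ℂ)) (mass_succ h k)
    have s := congrArg (fun x : ℝ => (x : ℂ)) (mass_succ h (k + 1))
    push_cast at r s
    have r' : (mass q c d (k + 1) : ℂ) * ((1 - (q : ℂ) ^ (k + 1)) * (1 - c / d * q ^ (k + 1)))
        * (mass q c d k : ℂ)⁻¹ = c / d * q ^ (2 * k + 1) := by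
      rw [r]; field_simp
    have s' : (mass q c d (k + 1) : ℂ) * (c / d * q ^ (2 * (k + 1) + 1)) * (mass q c d (k + 2) : ℂ)⁻¹
        = (1 - (q : ℂ) ^ (k + 2)) * (1 - c / d * q ^ (k + 2)) := by
      rw [← s]; field_simp
    have t : (mass q c d (k + 1) : ℂ) * (mass q c d (k + 1) : ℂ)⁻¹ = 1 := mul_inv_cancel₀ m1
    simp only [opL_succ h, rowVec, HilbertH.add_apply h, HilbertH.smul_apply h, evalVec_apply]
    simp [rowWeight]
    generalize (c : ℂ) / d = a at *
    have e3 : a * ((q : ℂ) ^ (k + 1)) ^ 2 / q = a * q ^ (2 * k + 1) := by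
      field_simp; ring
    rw [e3]
    linear_combination (1 - (q : ℂ) ^ (k + 1)) * (1 - a * q ^ (k + 1)) * r'
      + a * q ^ (2 * k + 3) * s' + ((1 + a) * q ^ (k + 1) - a * (1 + q) * (q ^ (k + 1)) ^ 2) ^ 2 * t

/-- The sum consists of geometric series in `q^{2k}`, `q^{3k}` and `q^{4k}`, and all dependence on
`a` cancels. The value equals `∑ q^{2n}`, the sum of squares of the eigenvalues `q^n` of `L + 1`
already known, so the Hilbert–Schmidt norm has no room for others. -/
lemma hasSum_rowWeight (h : Admissible q c d) (a : ℝ) :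
    HasSum (fun k => rowWeight q a (q ^ k)) (1 - q ^ 2)⁻¹ := by
  have hq := h.q_pos.ne'
  have g : ∀ m : ℕ, HasSum (fun k : ℕ => (q ^ k) ^ (m + 1)) (1 - q ^ (m + 1))⁻¹ := fun m => by
    have := hasSum_geometric_of_lt_one (pow_nonneg h.q_pos.le (m + 1)) (h.pow_succ_lt m)
    simpa only [← pow_mul, mul_comm] using this
  have := (((g 1).mul_left ((1 + a) ^ 2 + a / q + a * q)).add
    ((g 2).mul_left (-(a * (1 + a) * (2 + 2 * q + 1 / q + q ^ 2))))).add
    ((g 3).mul_left (a ^ 2 * (1 / q + (1 + q) ^ 2 + q ^ 3)))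
  have h2 : 1 - q ^ 2 ≠ 0 := real_one_sub_pow_ne_zero h.q_pos h.q_lt 1
  have h3 : 1 - q ^ 3 ≠ 0 := real_one_sub_pow_ne_zero h.q_pos h.q_lt 2
  have h4 : 1 - q ^ 4 ≠ 0 := real_one_sub_pow_ne_zero h.q_pos h.q_lt 3
  norm_num at this
  have e : (1 - q ^ 2)⁻¹ = ((1 + a) ^ 2 + a / q + a * q) * (1 - q ^ 2)⁻¹
      + -(a * (1 + a) * (2 + 2 * q + q⁻¹ + q ^ 2) * (1 - q ^ 3)⁻¹)
      + a ^ 2 * (q⁻¹ + (1 + q) ^ 2 + q ^ 3) * (1 - q ^ 4)⁻¹ := by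
    field_simp
    ring
  rw [e]
  refine this.congr_fun fun k => ?_
  simp only [rowWeight]
  field_simp
  ring

/-! ### Completeness of the polynomials -/

lemma inner_rowVec_unitV (h : Admissible q c d) (k n : ℕ) :
    inner ℂ (rowVec h k) (unitV h n) = q ^ n * unitV h n k := by
  have e : inner ℂ (rowVec h k) (vecV h n) = q ^ n * vecV h n k := by
    rw [inner_rowVec, show ((vecV h n : HilbertH q c d) : ℕ → ℂ)
      = fun j => (seqV q c d n j : ℂ) from funext fun j => vecV_apply h n j, seqV_opL h]
    ring
  rw [unitV, inner_smul_right, e, HilbertH.smul_apply h]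
  ring

/-- Bessel's inequality for each row of `L + 1`, applied to the orthonormal family of the `V_n`
enlarged by `f`, is summed over the rows. The polynomials alone account for the whole
Hilbert–Schmidt norm, so the contribution of `f` is zero. -/
lemma rowVec_orthogonal (h : Admissible q c d) {f : HilbertH q c d} (hf1 : ‖f‖ = 1)
    (hf : ∀ n, inner ℂ (unitV h n) f = 0) (k : ℕ) : inner ℂ (rowVec h k) f = 0 := by
  -- The index `none` carries the extra vector `f`.
  have ho : Orthonormal ℂ (fun o : Option ℕ => o.elim f (unitV h)) := by
    constructor
    · rintro (_ | n)
      · exact hf1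
      · exact (orthonormal_unitV h).1 n
    · rintro (_ | m) (_ | n) hmn
      · exact absurd rfl hmn
      · exact inner_eq_zero_symm.1 (hf n)
      · exact hf m
      · exact (orthonormal_unitV h).2 fun e => hmn (by rw [e])
  have hb : ∀ N k, mass q c d k * ‖inner ℂ (rowVec h k) f‖ ^ 2
      + ∑ n ∈ Finset.range N, (q ^ 2) ^ n * (mass q c d k * ‖unitV h n k‖ ^ 2)
      ≤ rowWeight q (c / d) (q ^ k) := fun N k => by
    have b := ho.sum_inner_products_le (x := rowVec h k) (s := Finset.insertNone (Finset.range N))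
    rw [Finset.sum_insertNone] at b
    have b2 := mul_le_mul_of_nonneg_left b (mass_pos h k).le
    rw [mass_mul_norm_rowVec_sq, mul_add, Finset.mul_sum] at b2
    refine le_of_eq_of_le ?_ b2
    congr 1
    · rw [norm_inner_symm]; rfl
    · refine Finset.sum_congr rfl fun n _ => ?_
      change _ = _ * ‖inner ℂ (unitV h n) (rowVec h k)‖ ^ 2
      rw [norm_inner_symm, inner_rowVec_unitV, norm_mul, mul_pow, norm_pow, Complex.norm_real,
        Real.norm_of_nonneg h.q_pos.le]
      ring
  have hs : Summable fun k => mass q c d k * ‖inner ℂ (rowVec h k) f‖ ^ 2 :=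
    (hasSum_rowWeight h (c / d)).summable.of_nonneg_of_le
      (fun k => mul_nonneg (mass_pos h k).le (sq_nonneg _)) fun k => by simpa using hb 0 k
  have hle : ∀ N, ∑' k, mass q c d k * ‖inner ℂ (rowVec h k) f‖ ^ 2
      + ∑ n ∈ Finset.range N, (q ^ 2) ^ n ≤ (1 - q ^ 2)⁻¹ := fun N => by
    have h1 : HasSum (fun k => ∑ n ∈ Finset.range N, (q ^ 2) ^ n * (mass q c d k * ‖unitV h n k‖ ^ 2))
        (∑ n ∈ Finset.range N, (q ^ 2) ^ n) := by
      refine hasSum_sum fun n _ => ?_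
      have := (hasSum_norm_sq h (unitV h n)).mul_left ((q ^ 2) ^ n)
      simpa [(orthonormal_unitV h).1 n] using this
    exact hasSum_le (hb N) (hs.hasSum.add h1) (hasSum_rowWeight h (c / d))
  have hlim : ∑' k, mass q c d k * ‖inner ℂ (rowVec h k) f‖ ^ 2 + (1 - q ^ 2)⁻¹
      ≤ (1 - q ^ 2)⁻¹ :=
    le_of_tendsto' ((hasSum_geometric_of_lt_one (sq_nonneg q)
      (h.pow_succ_lt 1)).tendsto_sum_nat.const_add _) hle
  have h0 : mass q c d k * ‖inner ℂ (rowVec h k) f‖ ^ 2 ≤ 0 :=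
    (hs.le_tsum k fun j _ => mul_nonneg (mass_pos h j).le (sq_nonneg _)).trans (by linarith)
  have h1 : ‖inner ℂ (rowVec h k) f‖ ^ 2 ≤ 0 := by
    by_contra hc
    exact absurd h0 (not_le.2 (mul_pos (mass_pos h k) (not_le.1 hc)))
  simpa using le_antisymm h1 (sq_nonneg _)

lemma Admissible.one_sub_ne (h : Admissible q c d) (k : ℕ) : 1 - c / d * q ^ (k + 1) ≠ 0 := by
  have := h.mul_pow_lt k
  rw [show c * q ^ (k + 1) / d = c / d * q ^ (k + 1) by ring] at this
  exact (sub_pos.2 this).ne'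

/-- At the eigenvalue `-1` the three-term recurrence integrates to a first-order one, so `f` is
determined by `f 0`. If `f 0 ≠ 0`, the terms of the series for the squared norm have ratio tending
to `d/(qc) > 1`, and the series diverges. -/
lemma eq_zero_of_opL_eq_neg (h : Admissible q c d) {f : HilbertH q c d}
    (hf : ∀ k, opL q c d f k + f k = 0) : f = 0 := by
  have hq := h.q_ne
  have hcd : (c : ℂ) / d ≠ 0 := div_ne_zero h.c_ne h.d_ne
  have hrec : ∀ k, (c : ℂ) / d * q ^ (k + 1) * f (k + 1) = -(1 - c / d * q ^ (k + 1)) * f k := by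
    intro k
    induction k with
    | zero =>
      have e := hf 0
      rw [opL_zero h] at e
      simp only [zero_add, pow_one]
      linear_combination e
    | succ k ih =>
      have e := hf (k + 1)
      rw [opL_succ h] at e
      have hk : (q : ℂ) ^ (k + 1) ≠ 0 := pow_ne_zero _ hq
      apply mul_left_cancel₀ hk
      linear_combination e - (1 - (q : ℂ) ^ (k + 1)) * ih
  have hreal : ∀ k, (1 - (c : ℂ) / d * q ^ (k + 1)) = ((1 - c / d * q ^ (k + 1) : ℝ) : ℂ) :=
    fun k => by push_cast; rfl
  by_cases h0 : f 0 = 0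
  · refine HilbertH.ext fun k => ?_
    rw [eq_of_ae_eq h (Lp.coeFn_zero ℂ 2 (jacksonMeasure q c d)) k]
    induction k with
    | zero => exact h0
    | succ k ih =>
      have e := hrec k
      rw [ih, Pi.zero_apply, mul_zero] at e
      exact (mul_eq_zero.1 e).resolve_left (mul_ne_zero hcd (pow_ne_zero _ hq))
  · exfalso
    have hne : ∀ k, f k ≠ 0 := fun k => by
      induction k with
      | zero => exact h0
      | succ k ih =>
        intro e0
        have e := hrec k
        rw [e0, mul_zero, eq_comm, mul_eq_zero, neg_eq_zero, hreal] at e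
        exact e.elim (fun e => h.one_sub_ne k (by exact_mod_cast e)) ih
    have hq' := h.q_pos
    have ha := div_pos h.c_pos h.d_pos
    refine not_summable_of_ratio_test_tendsto_gt_one (l := (c / d * q)⁻¹) ?_ ?_
      (hasSum_norm_sq h f).summable
    · rw [one_lt_inv₀ (by positivity), div_mul_eq_mul_div, div_lt_one h.d_pos, mul_comm]
      exact h.lt
    · have ht : Tendsto (fun k : ℕ => (1 - c / d * q ^ (k + 1)) / (1 - 1 * q ^ (k + 1))
          * (c / d * q)⁻¹) atTop (𝓝 (1 / 1 * (c / d * q)⁻¹)) :=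
        ((tendsto_one_sub_mul_pow h _).div (tendsto_one_sub_mul_pow h 1) one_ne_zero).mul_const _
      rw [div_one, one_mul] at ht
      refine ht.congr fun k => ?_
      have e1 : c / d * q ^ (k + 1) * ‖f (k + 1)‖ = |1 - c / d * q ^ (k + 1)| * ‖f k‖ := by
        have := congrArg (fun x : ℂ => ‖x‖) (hrec k)
        simp only [norm_mul, norm_neg, hreal, Complex.norm_real, Real.norm_eq_abs, norm_div, norm_pow,
          abs_of_pos h.c_pos, abs_of_pos h.d_pos, abs_of_pos h.q_pos] at this
        exact this
      have n1 : ‖f k‖ ≠ 0 := norm_ne_zero_iff.2 (hne k)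
      have e2 : ‖f (k + 1)‖ ^ 2 / ‖f k‖ ^ 2
          = (1 - c / d * q ^ (k + 1)) ^ 2 / (c / d * q ^ (k + 1)) ^ 2 := by
        rw [div_eq_div_iff (by positivity) (by positivity), ← sq_abs (1 - _), ← mul_pow, ← mul_pow,
          ← e1, mul_comm]
      rw [Real.norm_of_nonneg (mul_nonneg (mass_pos h _).le (sq_nonneg _)),
        Real.norm_of_nonneg (mul_nonneg (mass_pos h _).le (sq_nonneg _)), mul_div_mul_comm,
        e2, mass_succ_div h]
      have e3 := h.one_sub_ne k
      have e4 := real_one_sub_pow_ne_zero h.q_pos h.q_lt k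
      rw [one_mul]
      have ha' := ha.ne'
      generalize c / d = a at *
      generalize hM : 1 - a * q ^ (k + 1) = M at *
      field_simp
      ring

lemma unitV_orthogonal_eq_bot (h : Admissible q c d) :
    (Submodule.span ℂ (Set.range (unitV h)))ᗮ = ⊥ := by
  rw [eq_bot_iff]
  intro f hf
  have hf' : ∀ n, inner ℂ (unitV h n) f = 0 := fun n =>
    (Submodule.mem_orthogonal _ _).1 hf _ (Submodule.subset_span ⟨n, rfl⟩)
  by_contra hne
  have hne : f ≠ 0 := hne
  have hn : (‖f‖ : ℂ) ≠ 0 := by exact_mod_cast norm_ne_zero_iff.2 hne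
  -- Normalised so that `f` can join the orthonormal family in `rowVec_orthogonal`.
  have h1 : ‖(‖f‖ : ℂ)⁻¹ • f‖ = 1 := by
    rw [norm_smul, norm_inv, Complex.norm_real, norm_norm, inv_mul_cancel₀ (norm_ne_zero_iff.2 hne)]
  refine hne (eq_zero_of_opL_eq_neg h fun k => ?_)
  have := rowVec_orthogonal h h1 (fun n => by rw [inner_smul_right, hf', mul_zero]) k
  rw [inner_smul_right, mul_eq_zero] at this
  rw [← inner_rowVec]
  exact this.resolve_left (inv_ne_zero hn)

/-- The Hilbert basis of normalized Al-Salam--Carlitz polynomials. -/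
def basisV (h : Admissible q c d) : HilbertBasis ℕ ℂ (HilbertH q c d) :=
  HilbertBasis.mkOfOrthogonalEqBot (orthonormal_unitV h) (unitV_orthogonal_eq_bot h)

lemma basisV_apply (h : Admissible q c d) (n : ℕ) : basisV h n = unitV h n := by
  simp [basisV]

lemma span_vecV (h : Admissible q c d) :
    (Submodule.span ℂ (Set.range (vecV h))).topologicalClosure = ⊤ := by
  rw [eq_top_iff, ← (basisV h).dense_span]
  refine Submodule.topologicalClosure_mono (Submodule.span_le.2 ?_)
  rintro _ ⟨n, rfl⟩
  rw [basisV_apply, unitV]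
  exact Submodule.smul_mem _ _ (Submodule.subset_span ⟨n, rfl⟩)

/-- The total mass, from Parseval's identity for the evaluation at `1/c`. -/
lemma innerV_zero_zero (h : Admissible q c d) :
    innerV q c d 0 0 = (1 - q) / c * qPochInf q q := by
  have hq := h.q_pos
  have hc := h.c_pos
  have hd := h.d_pos
  have m0 := mass_pos h 0
  have hM := innerV_zero_pos h
  have hP := real_qPochInf_pos h.q_pos h.q_lt (h.mul_pow_pos 0).le (h.mul_pow_lt 0)
  rw [zero_add, pow_one] at hP
  have hp := (basisV h).hasSum_inner_mul_inner (evalVec h 0) (evalVec h 0)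
  -- In `V_n(1/c)² / ‖V_n‖²` the powers of `q` collapse to `q^n` because `n² = 2·(n choose 2) + n`.
  -- The sum over `n` is then Euler's series for `1/(cq/d;q)_∞`, while the squared norm of the
  -- evaluation vector is the inverse of the mass at `1/c`.
  have e1 : ∀ n, inner ℂ (evalVec h 0) (basisV h n) * inner ℂ (basisV h n) (evalVec h 0)
      = ((innerV q c d 0 0)⁻¹ : ℂ) * (((c * q / d : ℝ) : ℂ) ^ n / qPoch (q : ℂ) q n) := fun n => by
    rw [← inner_conj_symm (basisV h n), inner_evalVec, Complex.mul_conj', basisV_apply, unitV,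
      HilbertH.smul_apply h, vecV_apply, ← Complex.ofReal_pow, norm_mul, mul_pow, norm_inv,
      Complex.norm_real, Complex.norm_real, norm_norm, inv_pow, norm_vecV_sq, Real.norm_eq_abs,
      sq_abs, innerV_self h, seqV_at_zero h, ← ofReal_qPoch]
    norm_cast
    have hQ := (real_qPoch_pos h.q_pos h.q_lt n).ne'
    have e2 : q ^ n ^ 2 = (q ^ n.choose 2) ^ 2 * q ^ n := by
      rw [← pow_mul, ← pow_add]
      congr 1
      clear hQ
      induction n with
      | zero => rfl
      | succ n ih =>
        rw [Nat.choose_succ_succ' n 1, Nat.choose_one_right]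
        simp only [Nat.reduceAdd]
        linarith
    rw [e2, neg_pow, show c * q / d = c / d * q by ring, mul_pow (c / d) q]
    have e3 : ((-1 : ℝ) ^ n) ^ 2 = 1 := by rw [← pow_mul, mul_comm, pow_mul]; simp
    rw [mul_pow, mul_pow, e3]
    field_simp
  simp only [e1] at hp
  rw [inner_evalVec, evalVec_apply, if_pos rfl] at hp
  have he := (hasSum_pow_div_qPoch h.norm_lt (z := ((c * q / d : ℝ) : ℂ)) (by
    have := h.norm_mul_pow_lt 0
    simpa using this)).mul_left ((innerV q c d 0 0)⁻¹ : ℂ)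
  have hu := hp.unique he
  rw [← ofReal_qPochInf h.q_pos h.q_lt] at hu
  norm_cast at hu
  rw [← mul_inv, inv_inj, mass_zero h] at hu
  apply mul_right_cancel₀ hP.ne'
  rw [← hu]
  ring

lemma norm_vecV_sq_eq (h : Admissible q c d) (n : ℕ) : ‖vecV h n‖ ^ 2
    = (1 - q) / c * qPochInf q q * (c / d) ^ n * (q ^ (n ^ 2))⁻¹ * qPoch q q n := by
  rw [norm_vecV_sq, innerV_self h, innerV_zero_zero h]
  ring

end Coordinates

/-! ### Diagonal operators with respect to a Hilbert basis -/

section Diagonal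

variable {H : Type*} [NormedAddCommGroup H] [InnerProductSpace ℂ H]

lemma hilbertBasis_ext (b : HilbertBasis ℕ ℂ H) {x y : H}
    (h : ∀ n, inner ℂ (b n) x = inner ℂ (b n) y) : x = y :=
  b.repr.injective (by ext n; simp [b.repr_apply_apply, h])

lemma inner_basis_basis (b : HilbertBasis ℕ ℂ H) (m n : ℕ) :
    inner ℂ (b m) (b n) = if m = n then (1 : ℂ) else 0 :=
  orthonormal_iff_ite.1 b.orthonormal m n

lemma exists_diagonal (b : HilbertBasis ℕ ℂ H) {m : ℕ → ℂ} {C : ℝ} (hm : ∀ n, ‖m n‖ ≤ C) :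
    ∃ T : H →L[ℂ] H, ∀ f n, inner ℂ (b n) (T f) = m n * inner ℂ (b n) f := by
  have hC : 0 ≤ C := (norm_nonneg _).trans (hm 0)
  have h2 : 0 < (2 : ENNReal).toReal := by simp
  have hle : ∀ (f : lp (fun _ : ℕ => ℂ) 2) n, ‖m n * f n‖ ^ (2 : ENNReal).toReal
      ≤ C ^ (2 : ENNReal).toReal * ‖f n‖ ^ (2 : ENNReal).toReal := fun f n => by
    rw [norm_mul, Real.mul_rpow (norm_nonneg _) (norm_nonneg _)]
    have := hm n
    gcongr
  have hs : ∀ f : lp (fun _ : ℕ => ℂ) 2, Summable fun n => ‖m n * f n‖ ^ (2 : ENNReal).toReal :=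
    fun f => (((lp.memℓp f).summable h2).mul_left _).of_nonneg_of_le (fun n => by positivity) (hle f)
  let M : lp (fun _ : ℕ => ℂ) 2 →ₗ[ℂ] lp (fun _ : ℕ => ℂ) 2 :=
    { toFun := fun f => ⟨fun n => m n * f n, memℓp_gen (hs f)⟩
      map_add' := fun f g => by ext n; exact mul_add _ _ _
      map_smul' := fun x f => by ext n; simp; ring }
  have hM : ∀ f, ‖M f‖ ≤ C * ‖f‖ := fun f => by
    refine lp.norm_le_of_tsum_le h2 (by positivity) ?_
    rw [Real.mul_rpow hC (norm_nonneg _), lp.norm_rpow_eq_tsum h2, ← tsum_mul_left]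
    exact (hs f).tsum_le_tsum (hle f) (((lp.memℓp f).summable h2).mul_left _)
  refine ⟨b.repr.symm.toContinuousLinearEquiv.toContinuousLinearMap ∘L
    (M.mkContinuous C hM) ∘L b.repr.toContinuousLinearEquiv.toContinuousLinearMap, fun f n => ?_⟩
  rw [← b.repr_apply_apply, ← b.repr_apply_apply]
  simp [M]

variable {b : HilbertBasis ℕ ℂ H} {T : H →L[ℂ] H} {m : ℕ → ℂ}

lemma diagonal_apply (hT : ∀ f n, inner ℂ (b n) (T f) = m n * inner ℂ (b n) f) (n : ℕ) :
    T (b n) = m n • b n := by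
  refine hilbertBasis_ext b fun k => ?_
  rw [hT, inner_smul_right, inner_basis_basis]
  split_ifs with h
  · rw [h]
  · simp

lemma diagonal_isSelfAdjoint [CompleteSpace H]
    (hT : ∀ f n, inner ℂ (b n) (T f) = m n * inner ℂ (b n) f)
    (hm : ∀ n, (starRingEnd ℂ) (m n) = m n) : IsSelfAdjoint T := by
  rw [ContinuousLinearMap.isSelfAdjoint_iff']
  ext f
  refine hilbertBasis_ext b fun n => ?_
  rw [ContinuousLinearMap.adjoint_inner_right, hT, diagonal_apply hT, inner_smul_left, hm]

lemma eq_smul_of_diagonal_eigen (hT : ∀ f n, inner ℂ (b n) (T f) = m n * inner ℂ (b n) f)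
    (hinj : Function.Injective m) {n : ℕ} {f : H} (hf : T f = m n • f) :
    f = inner ℂ (b n) f • b n := by
  refine hilbertBasis_ext b fun k => ?_
  rw [inner_smul_right, inner_basis_basis]
  split_ifs with h
  · rw [h, mul_one]
  · have e := hT f k
    rw [hf, inner_smul_right] at e
    have e2 : (m n - m k) * inner ℂ (b k) f = 0 := by linear_combination e
    rw [mul_zero]
    exact (mul_eq_zero.1 e2).resolve_left (sub_ne_zero.2 fun e => h (hinj e.symm))

lemma exists_eq_of_diagonal_eigen (hT : ∀ f n, inner ℂ (b n) (T f) = m n * inner ℂ (b n) f)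
    {z : ℂ} {f : H} (hf0 : f ≠ 0) (hf : T f = z • f) : ∃ n, m n = z := by
  by_contra! hne
  refine hf0 (hilbertBasis_ext b fun n => ?_)
  have e := hT f n
  rw [hf, inner_smul_right] at e
  have e2 : (m n - z) * inner ℂ (b n) f = 0 := by linear_combination -e
  rw [inner_zero_right]
  exact (mul_eq_zero.1 e2).resolve_left (sub_ne_zero.2 (hne n))

lemma basis_ne_zero (b : HilbertBasis ℕ ℂ H) (n : ℕ) : b n ≠ 0 := b.orthonormal.ne_zero n

variable {ℓ : ℂ}

lemma mem_spectrum_of_diagonal [CompleteSpace H]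
    (hT : ∀ f n, inner ℂ (b n) (T f) = m n * inner ℂ (b n) f) (n : ℕ) : m n ∈ spectrum ℂ T := by
  intro hu
  have hb := ContinuousLinearMap.isUnit_iff_bijective.1 hu
  refine basis_ne_zero b n (hb.1 ?_)
  simp [diagonal_apply hT, Algebra.algebraMap_eq_smul_one]

/-- Away from the eigenvalues and their limit, the numbers `(z - m n)⁻¹` converge and hence are
bounded, so the diagonal operator they define is a bounded inverse. The limit belongs to the
spectrum because the spectrum is closed. -/
lemma spectrum_diagonal [CompleteSpace H]
    (hT : ∀ f n, inner ℂ (b n) (T f) = m n * inner ℂ (b n) f) (hℓ : Tendsto m atTop (𝓝 ℓ)) :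
    spectrum ℂ T = Set.range m ∪ {ℓ} := by
  have hr : Set.range m ⊆ spectrum ℂ T := by
    rintro _ ⟨n, rfl⟩; exact mem_spectrum_of_diagonal hT n
  refine Set.Subset.antisymm (fun z hz => ?_) (Set.union_subset hr ?_)
  · by_contra hne
    simp only [Set.mem_union, Set.mem_range, Set.mem_singleton_iff, not_or, not_exists] at hne
    have ht : Tendsto (fun n => ‖(z - m n)⁻¹‖) atTop (𝓝 ‖(z - ℓ)⁻¹‖) :=
      ((hℓ.const_sub z).inv₀ (sub_ne_zero.2 hne.2)).norm
    obtain ⟨C, hC⟩ := ht.bddAbove_range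
    obtain ⟨R, hR⟩ := exists_diagonal b (m := fun n => (z - m n)⁻¹) fun n => hC ⟨n, rfl⟩
    have h0 : ∀ n, z - m n ≠ 0 := fun n => sub_ne_zero.2 (Ne.symm (hne.1 n))
    have hZ : ∀ f n, inner ℂ (b n) ((algebraMap ℂ (H →L[ℂ] H) z - T) f)
        = (z - m n) * inner ℂ (b n) f := fun f n => by
      rw [Algebra.algebraMap_eq_smul_one]
      change inner ℂ (b n) (z • f - T f) = _
      rw [inner_sub_right, inner_smul_right, hT, sub_mul]
    refine hz (ContinuousLinearMap.isUnit_iff_bijective.2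
      (Function.bijective_iff_has_inverse.2 ⟨R, fun f => ?_, fun f => ?_⟩))
    · refine hilbertBasis_ext b fun n => ?_
      rw [hR, hZ, inv_mul_cancel_left₀ (h0 n)]
    · refine hilbertBasis_ext b fun n => ?_
      rw [hZ, hR, mul_inv_cancel_left₀ (h0 n)]
  · rintro _ rfl
    exact (spectrum.isClosed T).mem_of_tendsto hℓ
      (Eventually.of_forall fun n => hr ⟨n, rfl⟩)

lemma discreteSpec_diagonal [CompleteSpace H]
    (hT : ∀ f n, inner ℂ (b n) (T f) = m n * inner ℂ (b n) f) (hℓ : Tendsto m atTop (𝓝 ℓ))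
    (hinj : Function.Injective m) (hne : ∀ n, m n ≠ ℓ) : discreteSpec T = Set.range m := by
  refine Set.Subset.antisymm ?_ ?_
  · rintro z ⟨-, hz, -⟩
    obtain ⟨f, hf⟩ := hz.exists_hasEigenvector
    exact exists_eq_of_diagonal_eigen hT hf.2 hf.apply_eq_smul
  · rintro _ ⟨n, rfl⟩
    refine ⟨?_, ?_, ?_⟩
    · have ht : Tendsto (fun k => if k = n then ℓ else m k) atTop (𝓝 ℓ) := by
        refine hℓ.congr' ?_
        filter_upwards [eventually_gt_atTop n] with k hk
        rw [if_neg hk.ne']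
      have hK := ht.isCompact_insert_range.isClosed
      have hsub : ∀ k, k ≠ n → m k ∈ insert ℓ (Set.range fun k => if k = n then ℓ else m k) :=
        fun k hk => Or.inr ⟨k, if_neg hk⟩
      refine ⟨_, hK.isOpen_compl.mem_nhds (x := m n) ?_, ?_⟩
      · rintro (h | ⟨k, hk⟩)
        · exact hne n h
        · dsimp only at hk
          split_ifs at hk with h
          · exact hne n hk.symm
          · exact h (hinj hk)
      · rw [spectrum_diagonal hT hℓ]
        ext z
        simp only [Set.mem_inter_iff, Set.mem_compl_iff, Set.mem_singleton_iff]
        constructor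
        · rintro ⟨h1, ⟨k, rfl⟩ | h2⟩
          · by_contra hkn
            exact h1 (hsub k fun e => hkn (by rw [e]))
          · exact absurd (Or.inl h2) h1
        · rintro rfl
          refine ⟨?_, Or.inl ⟨n, rfl⟩⟩
          rintro (h | ⟨k, hk⟩)
          · exact hne n h
          · dsimp only at hk
            split_ifs at hk with h
            · exact hne n hk.symm
            · exact h (hinj hk)
    · refine Module.End.hasEigenvalue_of_hasEigenvector (x := b n) ⟨?_, basis_ne_zero b n⟩
      rw [Module.End.mem_eigenspace_iff]
      exact diagonal_apply hT n
    · refine Submodule.finiteDimensional_of_le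
        (S₂ := Submodule.span ℂ {b n}) fun f hf => ?_
      rw [Module.End.mem_eigenspace_iff] at hf
      rw [eq_smul_of_diagonal_eigen hT hinj hf]
      exact Submodule.smul_mem _ _ (Submodule.mem_span_singleton_self _)

/-- At `ℓ` the operator `T - ℓ` multiplies each basis vector by a nonzero number, so it is injective
with dense range; it cannot also be surjective, since `ℓ` lies in the spectrum. At an eigenvalue
injectivity fails. -/
lemma continuousSpec_diagonal [CompleteSpace H]
    (hT : ∀ f n, inner ℂ (b n) (T f) = m n * inner ℂ (b n) f) (hℓ : Tendsto m atTop (𝓝 ℓ))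
    (hne : ∀ n, m n ≠ ℓ) : continuousSpec T = {ℓ} := by
  have hZ : ∀ z f n, inner ℂ (b n) ((T - z • (1 : H →L[ℂ] H)) f)
      = (m n - z) * inner ℂ (b n) f := fun z f n => by
    change inner ℂ (b n) (T f - z • f) = _
    rw [inner_sub_right, inner_smul_right, hT, sub_mul]
  have hunit : ∀ z, z ∈ spectrum ℂ T ↔ ¬ Function.Bijective (T - z • (1 : H →L[ℂ] H)) := fun z => by
    rw [spectrum.mem_iff, ← ContinuousLinearMap.isUnit_iff_bijective, ← neg_sub, IsUnit.neg_iff,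
      Algebra.algebraMap_eq_smul_one]
  have hinj : ∀ z, (∀ n, m n ≠ z) → Function.Injective (T - z • (1 : H →L[ℂ] H)) := fun z hz => by
    rw [injective_iff_map_eq_zero]
    intro f hf
    refine hilbertBasis_ext b fun n => ?_
    have e := hZ z f n
    rw [hf, inner_zero_right, eq_comm, mul_eq_zero] at e
    rw [inner_zero_right]
    exact e.resolve_left (sub_ne_zero.2 (hz n))
  ext z
  rw [Set.mem_singleton_iff]
  constructor
  · rintro ⟨h1, -, h3⟩
    have hz : z ∈ spectrum ℂ T := (hunit z).2 fun hb => h3 hb.2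
    rw [spectrum_diagonal hT hℓ] at hz
    rcases hz with ⟨n, rfl⟩ | hz
    · refine absurd (h1 (a₁ := b n) (a₂ := 0) ?_) (basis_ne_zero b n)
      simp [diagonal_apply hT]
    · exact hz
  · rintro rfl
    refine ⟨hinj z hne, ?_, fun hs => ?_⟩
    · have hsub : Submodule.span ℂ (Set.range b)
          ≤ LinearMap.range (T - z • (1 : H →L[ℂ] H)).toLinearMap := by
        refine Submodule.span_le.2 ?_
        rintro _ ⟨n, rfl⟩
        refine ⟨(m n - z)⁻¹ • b n, hilbertBasis_ext b fun k => ?_⟩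
        refine (hZ z _ k).trans ?_
        rw [inner_smul_right, inner_basis_basis]
        split_ifs with h
        · rw [h, mul_one, mul_inv_cancel₀ (sub_ne_zero.2 (hne n))]
        · simp
      have hd : Dense (Submodule.span ℂ (Set.range b) : Set H) := by
        rw [dense_iff_closure_eq, ← Submodule.topologicalClosure_coe, b.dense_span]
        rfl
      exact hd.mono hsub
    · have hz : z ∈ spectrum ℂ T := by
        rw [spectrum_diagonal hT hℓ]; exact Or.inr rfl
      exact (hunit z).1 hz ⟨hinj z hne, hs⟩

lemma hasSum_inner_diagonal {P : H →L[ℂ] H} {m : ℕ → ℝ}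
    (hP : ∀ f n, inner ℂ (b n) (P f) = (m n : ℂ) * inner ℂ (b n) f) (f : H) :
    HasSum (fun n => m n * ‖inner ℂ (b n) f‖ ^ 2) (inner ℂ f (P f)).re := by
  have h := Complex.hasSum_re (b.hasSum_inner_mul_inner f (P f))
  refine h.congr_fun fun n => ?_
  rw [hP, ← inner_conj_symm f (b n), mul_left_comm, Complex.conj_mul', ← Complex.ofReal_pow,
    ← Complex.ofReal_mul, Complex.ofReal_re]

end Diagonal

/-! ### Existence and uniqueness of the spectral measure of a diagonal operator -/

section SpectralMeasure

variable {H : Type*} [NormedAddCommGroup H] [InnerProductSpace ℂ H] [CompleteSpace H]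
  {b : HilbertBasis ℕ ℂ H} {T : H →L[ℂ] H} {lam : ℕ → ℝ}

lemma norm_indicator_one_le (s : Set ℝ) (x : ℝ) : ‖s.indicator (1 : ℝ → ℂ) x‖ ≤ 1 := by
  by_cases h : x ∈ s <;> simp [h]

lemma exists_isSpectralMeasure (hT : ∀ f n, inner ℂ (b n) (T f) = (lam n : ℂ) * inner ℂ (b n) f)
    {R : ℝ} (hR : ∀ n, |lam n| ≤ R) : ∃ E : Set ℝ → H →L[ℂ] H, IsSpectralMeasure T E := by
  choose E hE using fun s : Set ℝ => exists_diagonal b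
    (m := fun n => s.indicator (1 : ℝ → ℂ) (lam n)) fun n => norm_indicator_one_le s (lam n)
  refine ⟨E, ?_, ?_, ?_, ?_, ?_⟩
  · intro s _
    refine ⟨?_, diagonal_isSelfAdjoint (hE s) fun n => ?_⟩
    · ext f
      refine hilbertBasis_ext b fun n => ?_
      rw [mul_apply_eq_comp, hE, hE]
      by_cases h : lam n ∈ s <;> simp [h]
    · by_cases h : lam n ∈ s <;> simp [h]
  · ext f
    refine hilbertBasis_ext b fun n => ?_
    simp [hE]
  · intro s t _ _
    ext f
    refine hilbertBasis_ext b fun n => ?_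
    rw [mul_apply_eq_comp, hE, hE, hE]
    by_cases h : lam n ∈ s <;> by_cases h' : lam n ∈ t <;> simp [h, h']
  · intro s _ hd f
    classical
    have h1 := b.hasSum_repr (E (⋃ i, s i) f)
    -- Groups the basis vectors by the set that contains their eigenvalue. The default value `0` is
    -- harmless: if no set contains `lam n`, every coefficient involved is zero.
    let g : ℕ → ℕ := fun n => if h : ∃ i, lam n ∈ s i then h.choose else 0
    refine (h1.tsum_fiberwise g).congr_fun fun i => ?_
    rw [tsum_subtype (g ⁻¹' {i}) fun n => b.repr (E (⋃ i, s i) f) n • b n,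
      ← (b.hasSum_repr (E (s i) f)).tsum_eq]
    refine tsum_congr fun n => ?_
    simp only [b.repr_apply_apply, hE]
    by_cases h : ∃ j, lam n ∈ s j
    · have hg : g n = h.choose := dif_pos h
      have hu : lam n ∈ ⋃ j, s j := Set.mem_iUnion.2 h
      by_cases hi : lam n ∈ s i
      · have : h.choose = i := by
          by_contra hne
          exact Set.disjoint_left.1 (hd hne) h.choose_spec hi
        rw [Set.indicator_of_mem (show n ∈ g ⁻¹' {i} from hg.trans this)]
        simp only [Set.indicator_of_mem hu, Set.indicator_of_mem hi]
      · rw [Set.indicator_of_notMem (s := g ⁻¹' {i})]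
        · simp [hi]
        · intro hn
          have : h.choose = i := hg.symm.trans hn
          exact hi (this ▸ h.choose_spec)
    · have hu : lam n ∉ ⋃ j, s j := fun hu => h (Set.mem_iUnion.1 hu)
      have hi : lam n ∉ s i := fun hi => h ⟨i, hi⟩
      rw [Set.indicator_of_notMem hi, zero_mul, zero_smul, Set.indicator_apply,
        Set.indicator_of_notMem hu, zero_mul, zero_smul, ite_self]
  · intro f
    have hc := hasSum_inner_diagonal (P := 1) (m := fun _ => 1) (b := b) (by simp) f
    simp only [one_mul] at hc
    let μ : Measure ℝ := Measure.sum fun n =>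
      ENNReal.ofReal (‖inner ℂ (b n) f‖ ^ 2) • Measure.dirac (lam n)
    have hi : Integrable (fun x : ℝ => x) μ := by
      refine integrable_sum_dirac (fun _ => ENNReal.ofReal_ne_top) ?_
      refine (hc.summable.mul_left R).of_nonneg_of_le (fun n => by positivity) fun n => ?_
      rw [ENNReal.toReal_ofReal (by positivity), mul_comm R, Real.norm_eq_abs]
      exact mul_le_mul_of_nonneg_left (hR n) (by positivity)
    refine ⟨μ, fun s hs => ?_, hi, ?_⟩
    · have h1 := hasSum_inner_diagonal (P := E s) (m := fun n => s.indicator 1 (lam n)) (b := b)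
        (fun f n => by rw [hE]; by_cases h : lam n ∈ s <;> simp [h]) f
      rw [Measure.sum_apply _ hs, ← h1.tsum_eq, ENNReal.ofReal_tsum_of_nonneg _ h1.summable]
      · refine tsum_congr fun n => ?_
        rw [Measure.smul_apply, Measure.dirac_apply' _ hs]
        by_cases h : lam n ∈ s <;> simp [h]
      · intro n
        exact mul_nonneg (Set.indicator_nonneg (fun _ _ => zero_le_one) _) (sq_nonneg _)
    · have h1 := hasSum_inner_diagonal hT f
      have h2 : ∫ x, x ∂μ = (inner ℂ f (T f)).re := by
        refine (integral_sum_dirac fun _ => ENNReal.ofReal_ne_top).trans ?_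
        rw [← h1.tsum_eq]
        refine tsum_congr fun n => ?_
        rw [ENNReal.toReal_ofReal (by positivity), smul_eq_mul, mul_comm]
      rw [h2]
      have hs := diagonal_isSelfAdjoint hT fun n => Complex.conj_ofReal _
      have : (starRingEnd ℂ) (inner ℂ f (T f)) = inner ℂ f (T f) := by
        rw [inner_conj_symm, ← ContinuousLinearMap.adjoint_inner_right,
          (ContinuousLinearMap.isSelfAdjoint_iff'.1 hs)]
      exact (Complex.conj_eq_iff_re.1 this).symm

variable {E : Set ℝ → H →L[ℂ] H}

lemma IsSpectralMeasure.inner_eq (hE : IsSpectralMeasure T E) {s : Set ℝ} (hs : MeasurableSet s)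
    (f g : H) : inner ℂ (E s f) g = inner ℂ f (E s g) := by
  have := (hE.proj s hs).isSelfAdjoint
  rw [ContinuousLinearMap.isSelfAdjoint_iff'] at this
  rw [← ContinuousLinearMap.adjoint_inner_right, this]

lemma IsSpectralMeasure.apply_apply (hE : IsSpectralMeasure T E) {s : Set ℝ}
    (hs : MeasurableSet s) (f : H) : E s (E s f) = E s f := by
  have := (hE.proj s hs).isIdempotentElem
  exact congrArg (fun P : H →L[ℂ] H => P f) this

lemma IsSpectralMeasure.inner_self (hE : IsSpectralMeasure T E) {s : Set ℝ}
    (hs : MeasurableSet s) (f : H) : inner ℂ f (E s f) = ((‖E s f‖ ^ 2 : ℝ) : ℂ) := by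
  conv_lhs => rw [← hE.apply_apply hs, ← hE.inner_eq hs, inner_self_eq_norm_sq_to_K]
  simp

/-- Only the weak formula for `⟨f, Tf⟩` is given. As `P = E s` commutes with every `E t`, the
measure of `f` is the sum of those of `P f` and `f - P f`. Hence `T` and `PTP + (1-P)T(1-P)` have
the same quadratic form, and they agree by polarisation. -/
lemma IsSpectralMeasure.commute (hE : IsSpectralMeasure T E) {s : Set ℝ} (hs : MeasurableSet s)
    (f : H) : T (E s f) = E s (T f) := by
  set P := E s with hP
  have key : ∀ f : H, inner ℂ f (T f)
      = inner ℂ (P f) (T (P f)) + inner ℂ (f - P f) (T (f - P f)) := fun f => by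
    obtain ⟨μ, h1, h2, h3⟩ := hE.integral f
    obtain ⟨μ', h1', h2', h3'⟩ := hE.integral (P f)
    obtain ⟨μ'', h1'', h2'', h3''⟩ := hE.integral (f - P f)
    have hμ : μ = μ' + μ'' := by
      ext t ht
      rw [Measure.add_apply, h1 t ht, h1' t ht, h1'' t ht, ← ENNReal.ofReal_add]
      · congr 1
        rw [← Complex.add_re]
        congr 1
        have hc : ∀ x, E t (P x) = P (E t x) := fun x => by
          have e1 := hE.inter s t hs ht
          have e2 := hE.inter t s ht hs
          rw [Set.inter_comm, e1] at e2
          exact (congrArg (fun Q : H →L[ℂ] H => Q x) e2).symm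
        have e3 : inner ℂ (P f) (E t (P f)) = inner ℂ f (P (E t f)) := by
          rw [hc, hE.inner_eq hs, hE.apply_apply hs]
        have e4 : inner ℂ (P f) (E t f) = inner ℂ f (P (E t f)) := hE.inner_eq hs _ _
        have e5 : inner ℂ f (E t (P f)) = inner ℂ f (P (E t f)) := by rw [hc]
        rw [map_sub, inner_sub_left, inner_sub_right, inner_sub_right, e3, e4, e5]
        ring
      · rw [hE.inner_self ht, Complex.ofReal_re]; positivity
      · rw [hE.inner_self ht, Complex.ofReal_re]; positivity
    rw [h3, h3', h3'', hμ, integral_add_measure h2' h2'', Complex.ofReal_add]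
  have hop : (T : H →ₗ[ℂ] H) = ((P * T * P + (1 - P) * T * (1 - P) : H →L[ℂ] H) : H →ₗ[ℂ] H) := by
    rw [← ext_inner_map]
    intro x
    have e := congrArg (starRingEnd ℂ) (key x)
    rw [map_add, inner_conj_symm, inner_conj_symm, inner_conj_symm] at e
    change inner ℂ (T x) x = inner ℂ (P (T (P x)) + (T (x - P x) - P (T (x - P x)))) x
    rw [e, inner_add_left, inner_sub_left, inner_sub_right, hE.inner_eq hs, hE.inner_eq hs]
  have hop' : ∀ x, T x = P (T (P x)) + (T (x - P x) - P (T (x - P x))) := fun x =>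
    congrArg (fun Q : H →ₗ[ℂ] H => Q x) hop
  have e1 := hop' (P f)
  have hPP : ∀ x, P (P x) = P x := hE.apply_apply hs
  rw [hPP, sub_self, map_zero, map_zero, sub_zero, add_zero] at e1
  have e2 := congrArg P (hop' f)
  rw [map_add, map_sub, hPP, hPP, sub_self, add_zero] at e2
  rw [e1, e2]

lemma IsSpectralMeasure.apply_empty (hE : IsSpectralMeasure T E) (f : H) : E ∅ f = 0 := by
  obtain ⟨μ, h1, -, -⟩ := hE.integral f
  have := h1 ∅ MeasurableSet.empty
  rw [measure_empty, hE.inner_self MeasurableSet.empty, Complex.ofReal_re, eq_comm,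
    ENNReal.ofReal_eq_zero] at this
  have h2 : ‖E ∅ f‖ ^ 2 = 0 := le_antisymm this (sq_nonneg _)
  simpa using h2

/-- `E s` commutes with `T` and the eigenvalues are simple, so it scales `b n`; idempotency leaves
only the factors `0` and `1`. -/
lemma IsSpectralMeasure.apply_basis_eq (hE : IsSpectralMeasure T E)
    (hT : ∀ f n, inner ℂ (b n) (T f) = (lam n : ℂ) * inner ℂ (b n) f)
    (hinj : Function.Injective lam) {s : Set ℝ} (hs : MeasurableSet s) (n : ℕ) :
    E s (b n) = 0 ∨ E s (b n) = b n := by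
  have h1 : T (E s (b n)) = (lam n : ℂ) • E s (b n) := by
    rw [hE.commute hs, diagonal_apply (m := fun n => (lam n : ℂ)) hT, map_smul]
  have h2 := eq_smul_of_diagonal_eigen (m := fun n => (lam n : ℂ)) hT
    (Complex.ofReal_injective.comp hinj) h1
  generalize inner ℂ (b n) (E s (b n)) = x at h2
  have h3 := hE.apply_apply hs (b n)
  rw [h2, map_smul, h2, smul_smul] at h3
  have h4 : x * x = x := smul_left_injective ℂ (basis_ne_zero b n) h3
  have h5 : x * (x - 1) = 0 := by linear_combination h4
  rcases mul_eq_zero.1 h5 with rfl | h6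
  · left; simpa using h2
  · right; rw [h2, sub_eq_zero.1 h6, one_smul]

/-- Otherwise the measure of `b n` would be a probability measure carried by `s`. Its mean is `lam
n`, which is impossible when `s` lies strictly on one side of `lam n`; the sign of `σ` selects the
side. -/
lemma IsSpectralMeasure.apply_eq_zero_of_ne (hE : IsSpectralMeasure T E)
    (hT : ∀ f n, inner ℂ (b n) (T f) = (lam n : ℂ) * inner ℂ (b n) f)
    (hinj : Function.Injective lam) {s : Set ℝ} (hs : MeasurableSet s) (n : ℕ) {σ : ℝ}
    (hσ : ∀ x ∈ s, 0 < σ * (x - lam n)) : E s (b n) = 0 := by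
  refine (hE.apply_basis_eq hT hinj hs n).resolve_right fun h1 => ?_
  obtain ⟨μ, hμ, hi, hint⟩ := hE.integral (b n)
  have hn : ‖b n‖ = 1 := b.orthonormal.1 n
  have huniv : μ Set.univ = 1 := by
    rw [hμ _ MeasurableSet.univ, hE.univ]
    simp [hn]
  have hμs : μ s = 1 := by
    rw [hμ s hs, h1]
    simp [hn]
  have hfin : IsProbabilityMeasure μ := ⟨huniv⟩
  have hae : ∀ᵐ x ∂μ, x ∈ s := by
    change μ sᶜ = 0
    rw [measure_compl hs (measure_ne_top _ _), hμs, huniv, tsub_self]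
  have hmean : ∫ x, x ∂μ = lam n := by
    rw [diagonal_apply (m := fun n => (lam n : ℂ)) hT, inner_smul_right,
      inner_self_eq_norm_sq_to_K, hn] at hint
    simp only [RCLike.ofReal_one, one_pow, mul_one] at hint
    exact_mod_cast hint.symm
  have h0 : ∫ x, σ * (x - lam n) ∂μ = 0 := by
    rw [integral_const_mul, integral_sub hi (integrable_const _), hmean]
    simp
  rw [integral_eq_zero_iff_of_nonneg_ae] at h0
  · have : ∀ᵐ x ∂μ, False := by
      filter_upwards [h0, hae] with x hx hxs
      exact (hσ x hxs).ne' hx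
    rw [ae_iff] at this
    simp [huniv] at this
  · filter_upwards [hae] with x hx using (hσ x hx).le
  · exact (hi.sub (integrable_const _)).const_mul _

/-- The two open half-lines beside `lam n` annihilate `b n`, so the whole mass sits at the point. -/
lemma IsSpectralMeasure.apply_singleton (hE : IsSpectralMeasure T E)
    (hT : ∀ f n, inner ℂ (b n) (T f) = (lam n : ℂ) * inner ℂ (b n) f)
    (hinj : Function.Injective lam) (n : ℕ) : E {lam n} (b n) = b n := by
  refine (hE.apply_basis_eq hT hinj (measurableSet_singleton _) n).resolve_left fun h0 => ?_
  have h1 := hE.apply_eq_zero_of_ne hT hinj (measurableSet_Iio (a := lam n)) n (σ := -1)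
    fun x hx => by have : x < lam n := hx; linarith
  have h2 := hE.apply_eq_zero_of_ne hT hinj (measurableSet_Ioi (a := lam n)) n (σ := 1)
    fun x hx => by have : lam n < x := hx; linarith
  obtain ⟨μ, hμ, -, -⟩ := hE.integral (b n)
  have e0 : μ {lam n} = 0 := by rw [hμ _ (measurableSet_singleton _), h0]; simp
  have e1 : μ (Set.Iio (lam n)) = 0 := by rw [hμ _ measurableSet_Iio, h1]; simp
  have e2 : μ (Set.Ioi (lam n)) = 0 := by rw [hμ _ measurableSet_Ioi, h2]; simp
  have huniv : μ Set.univ = 1 := by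
    rw [hμ _ MeasurableSet.univ, hE.univ]
    have hn : ‖b n‖ = 1 := b.orthonormal.1 n
    simp [hn]
  have hle : μ Set.univ ≤ 0 := by
    have : (Set.univ : Set ℝ) ⊆ Set.Iio (lam n) ∪ ({lam n} ∪ Set.Ioi (lam n)) := fun x _ => by
      rcases lt_trichotomy x (lam n) with h | h | h
      · exact Or.inl h
      · exact Or.inr (Or.inl h)
      · exact Or.inr (Or.inr h)
    refine (measure_mono this).trans ((measure_union_le _ _).trans ?_)
    rw [e1, zero_add]
    refine (measure_union_le _ _).trans ?_
    rw [e0, e2, zero_add]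
  rw [huniv] at hle
  simp at hle

lemma IsSpectralMeasure.inner_basis (hE : IsSpectralMeasure T E)
    (hT : ∀ f n, inner ℂ (b n) (T f) = (lam n : ℂ) * inner ℂ (b n) f)
    (hinj : Function.Injective lam) {s : Set ℝ} (hs : MeasurableSet s) (f : H) (n : ℕ) :
    inner ℂ (b n) (E s f) = s.indicator 1 (lam n) * inner ℂ (b n) f := by
  rw [← hE.inner_eq hs]
  have e : E (s ∩ {lam n}) (b n) = E s (b n) := by
    rw [hE.inter s _ hs (measurableSet_singleton _), mul_apply_eq_comp,
      hE.apply_singleton hT hinj]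
  by_cases h : lam n ∈ s
  · rw [Set.inter_eq_right.2 (Set.singleton_subset_iff.2 h), hE.apply_singleton hT hinj] at e
    simp [h, ← e]
  · rw [Set.inter_singleton_eq_empty.2 h, hE.apply_empty] at e
    simp [h, ← e]

lemma IsSpectralMeasure.apply_of_inter_range (hE : IsSpectralMeasure T E)
    (hT : ∀ f n, inner ℂ (b n) (T f) = (lam n : ℂ) * inner ℂ (b n) f)
    (hinj : Function.Injective lam) {s : Set ℝ} (hs : MeasurableSet s) {n : ℕ}
    (hn : s ∩ Set.range lam = {lam n}) (f : H) : E s f = inner ℂ (b n) f • b n := by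
  refine hilbertBasis_ext b fun k => ?_
  rw [hE.inner_basis hT hinj hs, inner_smul_right, inner_basis_basis]
  split_ifs with h
  · have : lam n ∈ s := (hn.symm.subset (Set.mem_singleton _)).1
    rw [h]; simp [this]
  · have : lam k ∉ s := fun hk =>
      h (hinj (hn.subset ⟨hk, k, rfl⟩))
    simp [this]

end SpectralMeasure

/-! ### The connection coefficient and the residues of `1 / D` -/

section Residue

/-- By Cauchy's formula the contour integral equals `h w` on every small circle, so the limit is
that of an eventually constant function. -/
lemma residueAt_eq {f h : ℂ → ℂ} {w : ℂ} {δ : ℝ} (hδ : 0 < δ)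
    (hh : DifferentiableOn ℂ h (Metric.ball w δ))
    (hf : ∀ z ∈ Metric.ball w δ, z ≠ w → f z = (z - w)⁻¹ * h z) : residueAt f w = h w := by
  refine Tendsto.limUnder_eq (tendsto_const_nhds.congr' ?_)
  filter_upwards [Ioo_mem_nhdsGT hδ] with r hr
  have h1 : ∮ z in C(w, r), f z = ∮ z in C(w, r), (z - w)⁻¹ • h z := by
    refine circleIntegral.integral_congr hr.1.le fun z hz => ?_
    have hz' : dist z w = r := hz
    refine hf z (by rw [Metric.mem_ball, hz']; exact hr.2) fun e => ?_
    rw [e, dist_self] at hz'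
    exact hr.1.ne hz'
  rw [h1, (hh.mono (Metric.closedBall_subset_ball hr.2)).circleIntegral_sub_inv_smul
    (Metric.mem_ball_self hr.1), smul_eq_mul, inv_mul_cancel_left₀]
  simp [Real.pi_ne_zero]

variable {q c d : ℝ}

/-! ### Quasi-periodicity of `θ` and the value of `C(q^n)` -/

lemma qTheta_mul (h : Admissible q c d) {x : ℂ} (hx : x ≠ 0) :
    qTheta q (x * q) = -x⁻¹ * qTheta q x := by
  have hq := h.q_ne
  rw [qTheta, qTheta, show (q : ℂ) / (x * q) = x⁻¹ by field_simp, qPochInf_eq_mul h.norm_lt x⁻¹,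
    qPochInf_eq_mul h.norm_lt x, mul_comm x, div_eq_mul_inv (q : ℂ) x]
  field_simp
  ring

lemma qTheta_mul_pow (h : Admissible q c d) {x : ℂ} (hx : x ≠ 0) (n : ℕ) :
    qTheta q (x * q ^ n) = (-x⁻¹) ^ n * ((q : ℂ) ^ n.choose 2)⁻¹ * qTheta q x := by
  have hq := h.q_ne
  induction n with
  | zero => simp
  | succ n ih =>
    rw [pow_succ (q : ℂ), ← mul_assoc, qTheta_mul h (mul_ne_zero hx (pow_ne_zero _ hq)), ih,
      Nat.choose_succ_succ' n 1, Nat.choose_one_right, mul_inv]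
    generalize x⁻¹ = y
    field_simp
    ring

/-- The function is entire and equals `1` at the origin, so its zeros are isolated by the identity
theorem. -/
lemma eventually_qPochInf_ne_zero (h : Admissible q c d) (x : ℂ) :
    ∀ᶠ t in 𝓝[≠] x, qPochInf t (q : ℂ) ≠ 0 := by
  by_contra hf
  have hf' : ∃ᶠ t in 𝓝[≠] x, qPochInf t (q : ℂ) = 0 :=
    (Filter.not_eventually.1 hf).mono fun t ht => not_not.1 ht
  have ha : AnalyticOnNhd ℂ (fun t => qPochInf t (q : ℂ)) Set.univ :=
    (differentiable_qPochInf h.norm_lt).differentiableOn.analyticOnNhd isOpen_univ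
  have := ha.eqOn_zero_of_preconnected_of_frequently_eq_zero isPreconnected_univ
    (Set.mem_univ x) hf' (Set.mem_univ 0)
  simp [qPochInf_zero] at this

lemma eventually_qTheta_ne_zero (h : Admissible q c d) {x : ℂ} (hx : x ≠ 0) :
    ∀ᶠ t in 𝓝[≠] x, qTheta q t ≠ 0 := by
  have hq := h.q_ne
  have ht : Tendsto (fun t : ℂ => (q : ℂ) / t) (𝓝[≠] x) (𝓝[≠] (q / x)) := by
    refine tendsto_nhdsWithin_iff.2 ⟨?_, ?_⟩
    · exact (tendsto_const_nhds.div tendsto_id hx).mono_left nhdsWithin_le_nhds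
    · filter_upwards [self_mem_nhdsWithin] with t (ht : t ≠ x) (e : (q : ℂ) / t = q / x)
      have ht0 : t ≠ 0 := by
        rintro rfl
        rw [div_zero, eq_comm] at e
        exact div_ne_zero hq hx e
      exact ht (mul_left_cancel₀ hq ((div_eq_div_iff ht0 hx).1 e)).symm
  filter_upwards [eventually_qPochInf_ne_zero h x,
    ht.eventually (eventually_qPochInf_ne_zero h (q / x))] with t h1 h2
  exact mul_ne_zero h1 h2

/-- Quasi-periodicity makes `θ(t q^n)/θ(t)` an explicit function continuous at `t = d/c`, so the
same formula holds when `θ(d/c)` vanishes. -/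
lemma connC_pow (h : Admissible q c d) (n : ℕ) :
    connC q c d ((q : ℂ) ^ n) = (-((c : ℂ) / d)) ^ n * ((q : ℂ) ^ n.choose 2)⁻¹ := by
  have hx : (d : ℂ) / c ≠ 0 := div_ne_zero h.d_ne h.c_ne
  have e : -((d : ℂ) / c)⁻¹ = -((c : ℂ) / d) := by rw [inv_div]
  unfold connC
  split_ifs with h0
  · rw [qTheta_mul_pow h hx, mul_div_cancel_right₀ _ h0, e]
  · refine Tendsto.limUnder_eq ?_
    have ht : Tendsto (fun t : ℂ => (-t⁻¹) ^ n * ((q : ℂ) ^ n.choose 2)⁻¹) (𝓝[≠] ((d : ℂ) / c))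
        (𝓝 ((-((c : ℂ) / d)) ^ n * ((q : ℂ) ^ n.choose 2)⁻¹)) := by
      rw [← e]
      exact ((((tendsto_id.inv₀ hx).neg).pow n).mul_const _).mono_left nhdsWithin_le_nhds
    refine ht.congr' ?_
    filter_upwards [eventually_qTheta_ne_zero h hx,
      nhdsWithin_le_nhds (isOpen_ne.mem_nhds hx)] with t h1 h2
    rw [qTheta_mul_pow h h2, mul_div_cancel_right₀ _ h1]

/-- The quotient `D(γ) / (γ - q^n)`. -/
def detQuot (q c : ℝ) (n : ℕ) (γ : ℂ) : ℂ :=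
  -((1 - q) / c) * qPochInf (q * γ) (q : ℂ) ^ 2 * qPoch γ⁻¹ (q : ℂ) n
    * qPochInf ((q : ℂ) ^ (n + 1) * γ⁻¹) (q : ℂ)

/-- The zero at `q^n` comes from the factor `1 - q^n/γ` of `(1/γ;q)_∞`; the quotient collects the
factors before and after it, together with a second copy of `(qγ;q)_∞`. -/
lemma detD_eq_mul_detQuot (h : Admissible q c d) (n : ℕ) {γ : ℂ} (hγ : γ ≠ 0) :
    detD q c d γ = (γ - q ^ n) * detQuot q c n γ := by
  have e1 := qPochInf_eq_qPoch_mul h.norm_lt γ⁻¹ (n + 1)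
  rw [qPochInf_eq_mul h.norm_lt γ⁻¹, qPoch_succ] at e1
  rw [detD_eq h hγ, detQuot, qPochInf_eq_mul h.norm_lt γ, mul_comm ((q : ℂ) ^ (n + 1)),
    div_eq_mul_inv (q : ℂ) γ]
  have e2 : (γ - q ^ n) = γ * (1 - γ⁻¹ * q ^ n) := by field_simp
  have e3 : (1 - γ) = -γ * (1 - γ⁻¹) := by field_simp; ring
  rw [e2, e3]
  linear_combination -((1 - q) / c) * qPochInf (q * γ) (q : ℂ) ^ 2 * γ * e1

lemma differentiableAt_detQuot (h : Admissible q c d) (n : ℕ) {γ : ℂ} (hγ : γ ≠ 0) :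
    DifferentiableAt ℂ (detQuot q c n) γ := by
  have hi : DifferentiableAt ℂ (fun z : ℂ => z⁻¹) γ := differentiableAt_inv hγ
  have hd := differentiable_qPochInf h.norm_lt
  have h1 : DifferentiableAt ℂ (fun z : ℂ => qPochInf (q * z) (q : ℂ)) γ :=
    DifferentiableAt.comp γ (hd _) (differentiableAt_id.const_mul _)
  have h2 : DifferentiableAt ℂ (fun z : ℂ => qPochInf ((q : ℂ) ^ (n + 1) * z⁻¹) (q : ℂ)) γ :=
    DifferentiableAt.comp γ (hd _) (hi.const_mul _)
  have h3 : DifferentiableAt ℂ (fun z : ℂ => qPoch z⁻¹ (q : ℂ) n) γ := by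
    unfold qPoch
    fun_prop (disch := assumption)
  exact (((h1.pow 2).const_mul _).mul h3).mul h2

lemma qPoch_inv_pow {K : Type*} [Field K] {q : K} (hq : q ≠ 0) (n : ℕ) :
    qPoch (q ^ n)⁻¹ q n = (-1) ^ n * (q ^ (n + 1).choose 2)⁻¹ * qPoch q q n := by
  induction n with
  | zero => simp
  | succ n ih =>
    rw [qPoch_succ', show q * (q ^ (n + 1))⁻¹ = (q ^ n)⁻¹ by rw [pow_succ]; field_simp, ih,
      qPoch_succ, Nat.choose_succ_succ' (n + 1) 1, Nat.choose_one_right]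
    field_simp
    ring

lemma detQuot_pow (h : Admissible q c d) (n : ℕ) :
    detQuot q c n ((q : ℂ) ^ n) = -((1 - q) / c) * qPochInf ((q : ℂ) ^ (n + 1)) (q : ℂ) ^ 2
      * ((-1) ^ n * ((q : ℂ) ^ (n + 1).choose 2)⁻¹ * qPoch (q : ℂ) q n)
      * qPochInf (q : ℂ) (q : ℂ) := by
  have hq := h.q_ne
  rw [detQuot, qPoch_inv_pow hq, ← pow_succ',
    show (q : ℂ) ^ (n + 1) * ((q : ℂ) ^ n)⁻¹ = q by rw [pow_succ]; field_simp]

lemma detQuot_pow_ne_zero (h : Admissible q c d) (n : ℕ) : detQuot q c n ((q : ℂ) ^ n) ≠ 0 := by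
  have hq := h.q_ne
  have h1 : (1 - q : ℂ) ≠ 0 := by simpa using one_sub_pow_ne_zero h.norm_lt 0
  rw [detQuot_pow h]
  refine mul_ne_zero (mul_ne_zero (mul_ne_zero (neg_ne_zero.2 (div_ne_zero h1 h.c_ne))
    (pow_ne_zero _ (h.pochQ_ne n))) (mul_ne_zero (mul_ne_zero (by simp)
      (inv_ne_zero (pow_ne_zero _ hq))) (qPoch_ne_zero_of_norm_lt h.norm_lt h.norm_lt n)))
    (qPochInf_ne_zero h.norm_lt h.norm_lt)

lemma residueAt_detD (h : Admissible q c d) (n : ℕ) :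
    residueAt (fun γ => 1 / detD q c d γ) ((q : ℂ) ^ n) = (detQuot q c n ((q : ℂ) ^ n))⁻¹ := by
  have hw : (q : ℂ) ^ n ≠ 0 := pow_ne_zero _ h.q_ne
  have h1 : ∀ᶠ z in 𝓝 ((q : ℂ) ^ n), z ≠ 0 ∧ detQuot q c n z ≠ 0 :=
    (isOpen_ne.eventually_mem hw).and
      ((differentiableAt_detQuot h n hw).continuousAt.eventually_ne (detQuot_pow_ne_zero h n))
  -- The disc avoids `0` and the zeros of the quotient, so `1/D` has only the simple pole at its
  -- centre.
  obtain ⟨δ, hδ, hb⟩ := Metric.eventually_nhds_iff_ball.1 h1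
  refine residueAt_eq (h := fun z => (detQuot q c n z)⁻¹) hδ (fun z hz => ?_) fun z hz _ => ?_
  · exact ((differentiableAt_detQuot h n (hb z hz).1).inv (hb z hz).2).differentiableWithinAt
  · rw [detD_eq_mul_detQuot h n (hb z hz).1, one_div, mul_inv]

/-- The normalization of the spectral projections. -/
lemma residue_mul_norm_sq (h : Admissible q c d) (n : ℕ) :
    -(1 / connC q c d ((q : ℂ) ^ n)) * residueAt (fun γ => 1 / detD q c d γ) ((q : ℂ) ^ n)
      * (qPochInf ((q : ℂ) ^ (n + 1)) (q : ℂ) ^ 2 * (‖vecV h n‖ : ℂ) ^ 2) = 1 := by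
  have hq := h.q_ne
  have hc := h.c_ne
  have hd := h.d_ne
  have h1 : (1 - q : ℂ) ≠ 0 := by simpa using one_sub_pow_ne_zero h.norm_lt 0
  have h2 := h.pochQ_ne n
  have h3 := qPoch_ne_zero_of_norm_lt h.norm_lt h.norm_lt n
  have h4 := qPochInf_ne_zero h.norm_lt h.norm_lt
  rw [residueAt_detD h, connC_pow h, detQuot_pow h, ← Complex.ofReal_pow ‖vecV h n‖, norm_vecV_sq_eq h]
  push_cast
  rw [ofReal_qPochInf h.q_pos h.q_lt, ofReal_qPoch, neg_pow]
  -- The powers of `q` from the residue and from `C(q^n)` combine by this identity to cancel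
  -- `q^{-n²}` in the norm.
  have e : (n + 1).choose 2 + n.choose 2 = n ^ 2 := by
    induction n with
    | zero => rfl
    | succ n ih =>
      have ih := ih (h.pochQ_ne n) (qPoch_ne_zero_of_norm_lt h.norm_lt h.norm_lt n)
      rw [Nat.choose_succ_succ' (n + 1) 1, Nat.choose_succ_succ' n 1, Nat.choose_one_right,
        Nat.choose_one_right]
      simp only [Nat.reduceAdd]
      rw [Nat.choose_succ_succ' n 1, Nat.choose_one_right] at ih
      simp only [Nat.reduceAdd] at ih
      linarith
  have e1 : ((-1 : ℂ) ^ n) * (-1) ^ n = 1 := by rw [← mul_pow]; simp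
  rw [← e, pow_add (q : ℂ) ((n + 1).choose 2)]
  generalize qPochInf ((q : ℂ) ^ (n + 1)) (q : ℂ) = P1 at *
  generalize qPochInf (q : ℂ) (q : ℂ) = P2 at *
  generalize qPoch (q : ℂ) (q : ℂ) n = P3 at *
  have hs : ((-1 : ℂ) ^ n) ≠ 0 := by simp
  generalize (-1 : ℂ) ^ n = σ at *
  field_simp
  linear_combination -e1

end Residue

/-! ### The operator `L` -/

section Operator

variable {q c d : ℝ}

lemma abs_pow_sub_one_le (h : Admissible q c d) (n : ℕ) : |q ^ n - 1| ≤ 1 := by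
  have h1 : 0 ≤ q ^ n := pow_nonneg h.q_pos.le n
  have h2 : q ^ n ≤ 1 := pow_le_one₀ h.q_pos.le h.q_lt.le
  rw [abs_le]; constructor <;> linarith

lemma exists_operator (h : Admissible q c d) : ∃ T : HilbertH q c d →L[ℂ] HilbertH q c d,
    ∀ f n, inner ℂ (basisV h n) (T f) = ((q ^ n - 1 : ℝ) : ℂ) * inner ℂ (basisV h n) f :=
  exists_diagonal (basisV h) (m := fun n => ((q ^ n - 1 : ℝ) : ℂ)) (C := 1) fun n => by
    rw [Complex.norm_real]; exact abs_pow_sub_one_le h n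

/-- The bounded operator `L`, with eigenvectors the Al-Salam--Carlitz polynomials. -/
def operatorL (h : Admissible q c d) : HilbertH q c d →L[ℂ] HilbertH q c d :=
  (exists_operator h).choose

lemma inner_operatorL (h : Admissible q c d) (f : HilbertH q c d) (n : ℕ) :
    inner ℂ (basisV h n) (operatorL h f)
      = ((q ^ n - 1 : ℝ) : ℂ) * inner ℂ (basisV h n) f := (exists_operator h).choose_spec f n

lemma operatorL_isSelfAdjoint (h : Admissible q c d) : IsSelfAdjoint (operatorL h) :=
  diagonal_isSelfAdjoint (m := fun n => ((q ^ n - 1 : ℝ) : ℂ)) (inner_operatorL h)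
    fun _ => Complex.conj_ofReal _

/-- The operator was defined only by its eigenvalues. Comparing coefficients in the basis shows that
`L + 1`, being symmetric, sends each evaluation vector to the vector of the corresponding row. -/
lemma operatorL_evalVec (h : Admissible q c d) (k : ℕ) :
    operatorL h (evalVec h k) + evalVec h k = rowVec h k := by
  refine hilbertBasis_ext (basisV h) fun n => ?_
  rw [inner_add_right, inner_operatorL, basisV_apply, ← inner_conj_symm _ (rowVec h k),
    inner_rowVec_unitV, ← inner_conj_symm _ (evalVec h k), inner_evalVec, map_mul, map_pow,
    Complex.conj_ofReal]
  push_cast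
  ring

/-- Self-adjointness moves the operator onto the evaluation vector, where the row vector reproduces
the difference expression for every `f` in `H`. -/
lemma operatorL_apply (h : Admissible q c d) (f : HilbertH q c d) (k : ℕ) :
    operatorL h f k = opL q c d f k := by
  have e := inner_rowVec h k f
  rw [← operatorL_evalVec, inner_add_left, inner_evalVec] at e
  rw [← inner_evalVec h k (operatorL h f), ← ContinuousLinearMap.adjoint_inner_left,
    ContinuousLinearMap.isSelfAdjoint_iff'.1 (operatorL_isSelfAdjoint h)]
  linear_combination e

lemma pow_sub_one_injective (h : Admissible q c d) : Function.Injective fun n : ℕ => q ^ n - 1 :=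
  fun _ _ e => pow_right_injective₀ h.q_pos h.q_lt.ne (sub_left_injective e)

lemma tendsto_pow_sub_one (h : Admissible q c d) :
    Tendsto (fun n : ℕ => ((q ^ n - 1 : ℝ) : ℂ)) atTop (𝓝 (-1)) := by
  have h1 : Tendsto (fun n : ℕ => q ^ n - 1) atTop (𝓝 (0 - 1)) :=
    (tendsto_pow_atTop_nhds_zero_of_lt_one h.q_pos.le h.q_lt).sub_const 1
  rw [zero_sub] at h1
  have := (Complex.continuous_ofReal.tendsto (-1)).comp h1
  rwa [Complex.ofReal_neg, Complex.ofReal_one] at this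

lemma pow_sub_one_ne (h : Admissible q c d) (n : ℕ) : ((q ^ n - 1 : ℝ) : ℂ) ≠ -1 := by
  intro e
  have e2 : (q : ℂ) ^ n = 0 := by push_cast at e; linear_combination e
  exact pow_ne_zero n h.q_ne e2

end Operator

end AlSalamCarlitz
end

theorem theorem4 (q c d : ℝ) (hq0 : 0 < q) (hq1 : q < 1) (hc : 0 < c) (hd : 0 < d)
    (hW : q * c < d) :
    ∃ (T : AlSalamCarlitz.HilbertH q c d →L[ℂ] AlSalamCarlitz.HilbertH q c d)
      (Φ V : ℕ → AlSalamCarlitz.HilbertH q c d),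
      -- `T` is the operator `L` on `H`
      (∀ (f : AlSalamCarlitz.HilbertH q c d) (k : ℕ), T f k = AlSalamCarlitz.opL q c d f k) ∧
      -- `Φ n` is the function `φ_γ` for `γ = q^n`
      (∀ n k : ℕ, Φ n k = AlSalamCarlitz.eigPhi q c d ((q : ℂ) ^ n) k) ∧
      -- `V n` is the function `x ↦ V_n^{(c/d)}(cx;q)`
      (∀ n k : ℕ, V n k
        = ((AlSalamCarlitz.polyV (c / d) q n (c * AlSalamCarlitz.pt q c k) : ℝ) : ℂ)) ∧
      -- (i) the spectrum
      IsSelfAdjoint T ∧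
      AlSalamCarlitz.discreteSpec T = Set.range (fun n : ℕ => (q : ℂ) ^ n - 1) ∧
      AlSalamCarlitz.continuousSpec T = {-1} ∧
      spectrum ℂ T = Set.range (fun n : ℕ => (q : ℂ) ^ n - 1) ∪ {-1} ∧
      -- the Casorati determinant of `φ_γ` and `Ψ_γ` does not depend on the point
      (∀ (γ : ℂ), γ ≠ 0 → ∀ j : ℕ,
        AlSalamCarlitz.casorati q c d (AlSalamCarlitz.eigPhi q c d γ)
          (AlSalamCarlitz.eigPsi q c d γ) j = AlSalamCarlitz.detD q c d γ) ∧
      -- (i) the spectral measure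
      (∃ E : Set ℝ → AlSalamCarlitz.HilbertH q c d →L[ℂ] AlSalamCarlitz.HilbertH q c d,
        AlSalamCarlitz.IsSpectralMeasure T E) ∧
      (∀ E : Set ℝ → AlSalamCarlitz.HilbertH q c d →L[ℂ] AlSalamCarlitz.HilbertH q c d,
        AlSalamCarlitz.IsSpectralMeasure T E →
        ∀ (n : ℕ) (a b : ℝ),
          Set.Ioo a b ∩ Set.range (fun m : ℕ => q ^ m - 1) = {q ^ n - 1} →
          ∀ f g : AlSalamCarlitz.HilbertH q c d,
            inner ℂ g (E (Set.Ioo a b) f)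
              = -(1 / AlSalamCarlitz.connC q c d ((q : ℂ) ^ n))
                * AlSalamCarlitz.residueAt (fun γ => 1 / AlSalamCarlitz.detD q c d γ) ((q : ℂ) ^ n)
                * inner ℂ (Φ n) f * inner ℂ g (Φ n)) ∧
      -- (ii) the orthogonal basis
      (∀ m n : ℕ, m ≠ n → inner ℂ (V m) (V n) = 0) ∧
      (Submodule.span ℂ (Set.range V)).topologicalClosure = ⊤ ∧
      (∀ n : ℕ, ‖V n‖ ^ 2
        = (1 - q) / c * AlSalamCarlitz.qPochInf q q * (c / d) ^ n * (q ^ (n ^ 2))⁻¹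
          * AlSalamCarlitz.qPoch q q n) := by
  open AlSalamCarlitz in
  have h : Admissible q c d := ⟨hq0, hq1, hc, hd, hW⟩
  have hr : (fun n : ℕ => ((q ^ n - 1 : ℝ) : ℂ)) = fun n : ℕ => (q : ℂ) ^ n - 1 := by
    funext n; push_cast; rfl
  have hT := inner_operatorL h
  have hinjC : Function.Injective fun n : ℕ => ((q ^ n - 1 : ℝ) : ℂ) :=
    Complex.ofReal_injective.comp (pow_sub_one_injective h)
  refine ⟨operatorL h, fun n => qPochInf ((q : ℂ) ^ (n + 1)) (q : ℂ) • vecV h n, vecV h,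
    operatorL_apply h, fun n k => ?_, vecV_apply h, operatorL_isSelfAdjoint h, ?_, ?_, ?_,
    fun γ hγ j => casorati_eq_detD h hγ j, ?_, fun E hE n a b hab f g => ?_, fun m n hmn => ?_,
    span_vecV h, norm_vecV_sq_eq h⟩
  · rw [HilbertH.smul_apply h, vecV_apply, eigPhi_pow h]
  · rw [← hr]
    exact discreteSpec_diagonal (m := fun n => ((q ^ n - 1 : ℝ) : ℂ)) hT (tendsto_pow_sub_one h)
      hinjC (pow_sub_one_ne h)
  · exact continuousSpec_diagonal (m := fun n => ((q ^ n - 1 : ℝ) : ℂ)) hT (tendsto_pow_sub_one h)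
      (pow_sub_one_ne h)
  · rw [← hr]
    exact spectrum_diagonal (m := fun n => ((q ^ n - 1 : ℝ) : ℂ)) hT (tendsto_pow_sub_one h)
  · exact exists_isSpectralMeasure (lam := fun n => q ^ n - 1) hT (abs_pow_sub_one_le h)
  · rw [hE.apply_of_inter_range (lam := fun n => q ^ n - 1) hT (pow_sub_one_injective h)
      measurableSet_Ioo hab f, basisV_apply]
    have hP : (starRingEnd ℂ) (qPochInf ((q : ℂ) ^ (n + 1)) (q : ℂ))
        = qPochInf ((q : ℂ) ^ (n + 1)) (q : ℂ) := by
      rw [← Complex.ofReal_pow, ← ofReal_qPochInf hq0 hq1, Complex.conj_ofReal]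
    rw [inner_smul_left, inner_smul_right, inner_smul_right, hP, vecV_eq_smul h n,
      inner_smul_left, inner_smul_right, Complex.conj_ofReal]
    -- `E(a,b)` is the projection onto the unit vector; passing to `Φ n` introduces the factor
    -- `(q^{n+1};q)_∞² ‖V_n‖²`, which the prefactor cancels.
    have e := residue_mul_norm_sq h n
    linear_combination (-(inner ℂ (unitV h n) f * inner ℂ g (unitV h n))) * e
  · rw [inner_vecV, innerV_of_ne h hmn, Complex.ofReal_zero]
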